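/- Let $x_1,\dots,x_n$ be distinct points of $\mathbb P^2_{\mathbb C}$ (in particular, $n$ very general points), let $f\colon X_n\to\mathbb P^2$ be the blow-up of the plane at these points, with line class $L=f^*\mathcal O_{\mathbb P^2}(1)$ and exceptional curves $E_1,\dots,E_n$, so that $\mathrm{Pic}(X_n)$ is free on $L,E_1,\dots,E_n$, and let $N_1(X_n)=\mathrm{Pic}(X_n)\otimes_{\mathbb Z}\mathbb R$ carry the intersection form ($L^2=1$, $E_i^2=-1$, all other products of basis elements $0$). Write $K_n=-3L+\sum_i E_i$ for the canonical class. A class $dL-\sum_i m_iE_i$ in $\mathrm{Pic}(X_n)$ is effective if it has a nonzero global section, i.e. if there is a nonzero ternary form of degree $d$ that vanishes to order at least $m_i$ at $x_i$ for every $i$ (no condition when $m_i\le 0$). The ray of a nonzero $\xi\in N_1(X_n)$ is $[\xi]=\{\lambda\xi:\lambda>0\}$; a ray is rational if it is generated by a class in $\mathrm{Pic}(X_n)\otimes\mathbb Q$, and effective if it is generated by an effective class. Let $\overline{\mathrm{NE}}(X_n)$ (the Mori cone) be the closure of the union of all effective rays, let $\mathrm{Nef}(X_n)$ (the nef cone)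 be the set of $\xi\in N_1(X_n)$ with $\xi\cdot D\ge 0$ for every effective class $D$, and let $\mathcal Q_n=\{\xi\in N_1(X_n):\xi\cdot L\ge 0,\ \xi^2\ge 0\}$ be the nonnegative cone, with boundary $\partial\mathcal Q_n$. A ray $\rho$ contained in a cone $A$ is extremal for $A$ if, whenever $\alpha,\beta\in A$ and $\alpha+\beta\in\rho$, both $\alpha$ and $\beta$ lie in $\rho\cup\{0\}$. Then every rational ray $\rho\subseteq\partial\mathcal Q_n$ that is not effective is nef, i.e. $\rho\subseteq\mathrm{Nef}(X_n)$, and is extremal for both $\overline{\mathrm{NE}}(X_n)$ and $\mathrm{Nef}(X_n)$. Moreover, $\rho\subseteq\partial\mathcal Q_n\cap\{\xi\in\overline{\mathrm{NE}}(X_n):\xi\cdot K_n\ge 0\}$. -/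

import Mathlib

/-!
Divisor classes on the blow-up `f : X → ℙ²` of the complex projective plane at `n` distinct
points `x 0, …, x (n-1)`.  With `L` the pull-back of a line and `E i` the exceptional curve over
`x i`, the group `Pic X` is free on `L, E 0, …, E (n-1)`.  The class `d L - ∑ i, m i • E i` is
written `(d, m)`, and `H⁰(X, d L - ∑ i, m i • E i)` is the space of ternary forms of degree `d`
with multiplicity at least `m i` at every `x i` (no condition at `x i` when `m i ≤ 0`).
-/

namespace BlownUpPlane

/-- Closed points of the complex projective plane. -/
abbrev Plane : Type := Projectivization ℂ (Fin 3 → ℂ)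

/-- `F` vanishes to order at least `m` at `v`: the Taylor expansion `F (v + Y)` has no term of
degree smaller than `m` in `Y`. For `m ≤ 0` there is no condition. -/
def VanishesToOrder (F : MvPolynomial (Fin 3) ℂ) (v : Fin 3 → ℂ) (m : ℤ) : Prop :=
  ∀ s : Fin 3 →₀ ℕ, (s.degree : ℤ) < m →
    MvPolynomial.coeff s
      (MvPolynomial.aeval (fun j => MvPolynomial.X j + MvPolynomial.C (v j)) F :
        MvPolynomial (Fin 3) ℂ) = 0

/-- `Pic X`: the pair `(d, m)` is the class `d L - ∑ i, m i • E i`. -/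
abbrev Pic (n : ℕ) : Type := ℤ × (Fin n → ℤ)

/-- `N₁(X) = Pic X ⊗ ℝ`, in coordinates with respect to the basis `(L, -E 0, …, -E (n-1))`. -/
abbrev N1 (n : ℕ) : Type := ℝ × (Fin n → ℝ)

variable {n : ℕ}

/-- The inclusion of `Pic X` in `N₁(X)`. -/
def Pic.toN1 (D : Pic n) : N1 n := ((D.1 : ℝ), fun i => (D.2 i : ℝ))

/-- The intersection form: `L² = 1`, `E i ² = -1`, all other products of basis elements are `0`. -/
def inter (ξ η : N1 n) : ℝ := ξ.1 * η.1 - ∑ i, ξ.2 i * η.2 i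

/-- The class `L` of the pull-back of a line. -/
def lineClass (n : ℕ) : N1 n := (1, fun _ => 0)

/-- The canonical class `K = -3 L + ∑ i, E i`. -/
def canonicalClass (n : ℕ) : N1 n := (-3, fun _ => -1)

/-- The forms that define the linear system `|d L - ∑ i, m i • E i|`: ternary forms of degree `d`
with multiplicity at least `m i` at `x i`. The multiplicity of a form at a point of the plane is
its order of vanishing at any vector that represents the point. -/
def linearSystem (x : Fin n → Plane) (D : Pic n) : Set (MvPolynomial (Fin 3) ℂ) :=
  {F | (∃ d : ℕ, (d : ℤ) = D.1 ∧ F.IsHomogeneous d) ∧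
    ∀ i, VanishesToOrder F (x i).rep (D.2 i)}

/-- A class in `Pic X` is effective if it has a nonzero section. -/
def IsEffective (x : Fin n → Plane) (D : Pic n) : Prop :=
  ∃ F ∈ linearSystem x D, F ≠ 0

/-- The open half-line spanned by `ξ`. -/
def ray (ξ : N1 n) : Set (N1 n) := {η | ∃ c : ℝ, 0 < c ∧ η = c • ξ}

/-- A class in `N₁(X)` is rational if it lies in `Pic X ⊗ ℚ`. -/
def IsRational (ξ : N1 n) : Prop :=
  (∃ q : ℚ, ξ.1 = q) ∧ ∀ i, ∃ q : ℚ, ξ.2 i = q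

/-- A rational ray is a ray generated by a nonzero rational class. -/
def IsRationalRay (ρ : Set (N1 n)) : Prop :=
  ∃ ξ : N1 n, ξ ≠ 0 ∧ IsRational ξ ∧ ρ = ray ξ

/-- An effective ray is a ray generated by a nonzero effective class. -/
def IsEffectiveRay (x : Fin n → Plane) (ρ : Set (N1 n)) : Prop :=
  ∃ D : Pic n, D ≠ 0 ∧ IsEffective x D ∧ ρ = ray D.toN1

/-- The Mori cone: the closure of the union of all effective rays. -/
def moriCone (x : Fin n → Plane) : Set (N1 n) :=
  closure (⋃₀ {ρ | IsEffectiveRay x ρ})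

/-- The nef cone: the classes whose intersection with every effective class is nonnegative. -/
def nefCone (x : Fin n → Plane) : Set (N1 n) :=
  {ξ | ∀ D : Pic n, IsEffective x D → 0 ≤ inter ξ D.toN1}

/-- The nonnegative cone: `ξ · L ≥ 0` and `ξ² ≥ 0`. -/
def nonnegCone (n : ℕ) : Set (N1 n) :=
  {ξ | 0 ≤ inter ξ (lineClass n) ∧ 0 ≤ inter ξ ξ}

/-- The part of the Mori cone on which the intersection with `K` is nonnegative. -/
def moriConeKNonneg (x : Fin n → Plane) : Set (N1 n) :=
  {ξ ∈ moriCone x | 0 ≤ inter ξ (canonicalClass n)}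

/-- The ray `ρ` is extremal for the cone `A`: it lies in `A`, and if a sum of two elements of `A`
is on `ρ`, then both summands are on `ρ` or zero. -/
def IsExtremalRay (A ρ : Set (N1 n)) : Prop :=
  ρ ⊆ A ∧ ∀ α ∈ A, ∀ β ∈ A, α + β ∈ ρ → α ∈ insert 0 ρ ∧ β ∈ insert 0 ρ

end BlownUpPlane

/-!
Counting the conditions imposed by the points makes `D` effective as soon as `D · L ≥ 0` and
`D² ≥ D · K`; in particular `D` is ℚ-effective if `D · L ≥ 0` and `D² > 0`. Now let `D` be an
integral null class with no effective multiple. The count gives `D · K ≥ 0`. If `D · E < 0` for an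
effective `E`, then `(N D - E)² > 0` for large `N`, so `N D - E` is ℚ-effective and hence so is `D`,
a contradiction: `D` is nef. Since `D` is null, the intersection form is negative semidefinite on
`D^⊥`, with kernel spanned by `D`. If two classes in the Mori cone add up to a multiple of `D`, both
lie in `D^⊥`, because `D` is nef. Nef classes have nonnegative square, so those in `D^⊥` are
multiples of `D`: this is extremality in the nef cone.

For the Mori cone, Bézout's inequality shows that distinct irreducible curves meet nonnegatively. A
linear relation between irreducible curves in `D^⊥` separates into two nonnegative combinations `P`
of disjoint sets of curves, so `P² ≥ 0` and `P` is a multiple of `D`. By Diophantine approximation a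
nontrivial combination of this kind would give an effective multiple of `D`. So the curves in `D^⊥`
are linearly independent, and there are finitely many of them. Subtracting from a class of the Mori
cone in `D^⊥` as much of these curves as possible leaves a nef class, as in a Zariski decomposition,
and that class is a multiple of `D`. The coefficients of the curves vanish, by Diophantine
approximation again, when two such classes add up to a multiple of `D`.
-/

namespace BlownUpPlane

open Filter MvPolynomial Topology
open scoped LinearAlgebra.Projectivization

section Order

variable {σ τ R : Type*} [CommRing R]

/-- The Taylor expansion `F (v + Y)` of a polynomial `F` at `v`, as a polynomial in `Y`. -/
noncomputable def taylor (v : σ → R) : MvPolynomial σ R →ₐ[R] MvPolynomial σ R :=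
  aeval fun j => X j + C (v j)

theorem taylor_neg_taylor (v : σ → R) (F : MvPolynomial σ R) : taylor (-v) (taylor v F) = F := by
  have h : (taylor (-v)).comp (taylor v) = AlgHom.id R _ := by
    ext j : 1
    simp [taylor]
  exact DFunLike.congr_fun h F

theorem taylor_injective (v : σ → R) : Function.Injective (taylor v) :=
  Function.LeftInverse.injective (taylor_neg_taylor v)

theorem totalDegree_taylor_le (v : σ → R) (F : MvPolynomial σ R) :
    (taylor v F).totalDegree ≤ F.totalDegree := by
  have hX (j : σ) : (X j + C (v j) : MvPolynomial σ R).totalDegree ≤ 1 :=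
    (totalDegree_add _ _).trans (max_le (isHomogeneous_X R j).totalDegree_le (by simp))
  rw [taylor, aeval_def, eval₂_eq]
  refine totalDegree_finsetSum_le fun s hs => ?_
  calc (C (coeff s F) * ∏ j ∈ s.support, (X j + C (v j)) ^ s j).totalDegree
      ≤ (∏ j ∈ s.support, (X j + C (v j)) ^ s j).totalDegree := by
        simpa using totalDegree_mul (C (coeff s F)) (∏ j ∈ s.support, (X j + C (v j)) ^ s j)
    _ ≤ ∑ j ∈ s.support, ((X j + C (v j)) ^ s j).totalDegree := totalDegree_finsetProd _ _
    _ ≤ ∑ j ∈ s.support, s j := by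
        gcongr with j
        exact (totalDegree_pow _ _).trans (mul_le_of_le_one_right (Nat.zero_le _) (hX j))
    _ ≤ F.totalDegree := le_totalDegree hs

/-- The order of vanishing of a polynomial at `v`. It is `⊤` exactly for the zero polynomial. -/
noncomputable def ord (v : σ → R) (F : MvPolynomial σ R) : ℕ∞ :=
  (taylor v F : MvPowerSeries σ R).order

theorem natCast_le_order_coe_iff {G : MvPolynomial σ R} {m : ℕ} :
    (m : ℕ∞) ≤ (G : MvPowerSeries σ R).order ↔ ∀ s : σ →₀ ℕ, s.degree < m → coeff s G = 0 := by
  refine ⟨fun h s hs => ?_, fun h => MvPowerSeries.nat_le_order fun s hs => ?_⟩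
  · rw [← coeff_coe]
    exact MvPowerSeries.coeff_of_lt_order (lt_of_lt_of_le (by exact_mod_cast hs) h)
  · rw [coeff_coe, h s hs]

theorem order_coe_le_totalDegree {G : MvPolynomial σ R} (hG : G ≠ 0) :
    (G : MvPowerSeries σ R).order ≤ G.totalDegree := by
  obtain ⟨s, hs⟩ := ne_zero_iff.mp hG
  calc (G : MvPowerSeries σ R).order ≤ s.degree := MvPowerSeries.order_le (by rwa [coeff_coe])
    _ ≤ G.totalDegree := by exact_mod_cast le_totalDegree (mem_support_iff.mpr hs)

theorem order_coe_le_order_coe_aeval {f : σ → MvPolynomial τ R}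
    (hf : ∀ j, constantCoeff (f j) = 0) (G : MvPolynomial σ R) :
    (G : MvPowerSeries σ R).order ≤ (aeval f G : MvPowerSeries τ R).order := by
  refine ENat.forall_natCast_le_iff_le.mp fun m hm => ?_
  rw [natCast_le_order_coe_iff] at hm ⊢
  intro s hs
  rw [aeval_def, eval₂_eq, coeff_sum]
  refine Finset.sum_eq_zero fun u hu => ?_
  have hmu : m ≤ u.degree := not_lt.mp fun hlt => mem_support_iff.mp hu (hm u hlt)
  have hprod : (u.degree : ℕ∞) ≤
      ((∏ j ∈ u.support, f j ^ u j : MvPolynomial τ R) : MvPowerSeries τ R).order := by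
    rw [← coeToMvPowerSeries.ringHom_apply, map_prod, Finsupp.degree_apply, Nat.cast_sum]
    refine (Finset.sum_le_sum fun j _ => ?_).trans (MvPowerSeries.le_order_prod _ _)
    have hj : 1 ≤ (f j : MvPowerSeries τ R).order := by
      rw [MvPowerSeries.one_le_order_iff_constCoeff_eq_zero]
      exact hf j
    calc (u j : ℕ∞) = u j • 1 := by simp
      _ ≤ u j • (f j : MvPowerSeries τ R).order := nsmul_le_nsmul_right hj _
      _ ≤ _ := by simpa using MvPowerSeries.le_order_pow (u j)
  rw [algebraMap_eq, coeff_C_mul, natCast_le_order_coe_iff.mp hprod s (hs.trans_le hmu), mul_zero]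

theorem ord_zero (v : σ → R) : ord v 0 = ⊤ := by simp [ord]

theorem ord_ne_top {F : MvPolynomial σ R} (hF : F ≠ 0) (v : σ → R) : ord v F ≠ ⊤ := by
  rw [ord, Ne, MvPowerSeries.order_eq_top_iff, coe_eq_zero_iff]
  exact (map_ne_zero_iff _ (taylor_injective v)).mpr hF

theorem ord_le_of_isHomogeneous {F : MvPolynomial σ R} {d : ℕ} (hF : F.IsHomogeneous d)
    (hF0 : F ≠ 0) (v : σ → R) : ord v F ≤ d := by
  have h0 : taylor v F ≠ 0 := (map_ne_zero_iff _ (taylor_injective v)).mpr hF0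
  refine (order_coe_le_totalDegree h0).trans ?_
  exact_mod_cast (totalDegree_taylor_le v F).trans hF.totalDegree_le

theorem one_le_ord_iff {v : σ → R} {F : MvPolynomial σ R} : 1 ≤ ord v F ↔ eval v F = 0 := by
  have h : constantCoeff (taylor v F) = eval v F := by
    have : (constantCoeff (R := R) (σ := σ)).comp (taylor v : MvPolynomial σ R →+* _) = eval v :=
      MvPolynomial.ringHom_ext (by simp [taylor]) (by simp [taylor])
    exact DFunLike.congr_fun this F
  rw [ord, ← Nat.cast_one, natCast_le_order_coe_iff, ← h]
  simp [constantCoeff_eq, Finsupp.degree_eq_zero_iff]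

/-- The polynomials that vanish to order at least `m` at `v`. -/
noncomputable def vanishing (v : σ → R) (m : ℕ) : Submodule R (MvPolynomial σ R) where
  carrier := {F | (m : ℕ∞) ≤ ord v F}
  zero_mem' := by simp [ord_zero]
  add_mem' {F G} hF hG := by
    simp only [Set.mem_ofPred_eq, ord, map_add, coe_add] at *
    exact (le_min hF hG).trans MvPowerSeries.min_order_le_add
  smul_mem' c F hF := by
    simp only [Set.mem_ofPred_eq, ord, map_smul, coe_smul] at *
    exact hF.trans MvPowerSeries.le_order_smul

theorem mem_vanishing {v : σ → R} {m : ℕ} {F : MvPolynomial σ R} :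
    F ∈ vanishing v m ↔ (m : ℕ∞) ≤ ord v F := Iff.rfl

theorem isHomogeneous_totalDegree_iff {G : MvPolynomial σ R} :
    G.IsHomogeneous G.totalDegree ↔ (G.totalDegree : ℕ∞) ≤ (G : MvPowerSeries σ R).order := by
  rw [natCast_le_order_coe_iff]
  refine ⟨fun h s hs => h.coeff_eq_zero hs.ne, fun h s hs => ?_⟩
  have hle : s.degree ≤ G.totalDegree := le_totalDegree (mem_support_iff.mpr hs)
  have hge : G.totalDegree ≤ s.degree := not_lt.mp fun hlt => hs (h s hlt)
  rw [← hle.antisymm hge, Finsupp.degree_eq_weight_one]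
  rfl

/-- The order of vanishing at `v` of a nonzero polynomial as a natural number; `mult v 0 = 0`. -/
noncomputable def mult (v : σ → R) (F : MvPolynomial σ R) : ℕ := (ord v F).toNat

theorem natCast_mult {F : MvPolynomial σ R} (hF : F ≠ 0) (v : σ → R) :
    (mult v F : ℕ∞) = ord v F :=
  ENat.natCast_toNat (ord_ne_top hF v)

variable [IsDomain R]

theorem ord_mul (v : σ → R) (F G : MvPolynomial σ R) : ord v (F * G) = ord v F + ord v G := by
  simp [ord, MvPowerSeries.order_mul]

theorem ord_one (v : σ → R) : ord v 1 = 0 := by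
  have h : ¬ 1 ≤ ord v (1 : MvPolynomial σ R) := by simp [one_le_ord_iff]
  simpa [Order.one_le_iff_pos] using h

theorem ord_pow (v : σ → R) (F : MvPolynomial σ R) (k : ℕ) : ord v (F ^ k) = k * ord v F := by
  induction k with
  | zero => simp [ord_one]
  | succ k ih => rw [pow_succ, ord_mul, ih, Nat.cast_succ, add_mul, one_mul]

theorem mult_mul {F G : MvPolynomial σ R} (hF : F ≠ 0) (hG : G ≠ 0) (v : σ → R) :
    mult v (F * G) = mult v F + mult v G := by
  rw [mult, ord_mul, ENat.toNat_add (ord_ne_top hF v) (ord_ne_top hG v), mult, mult]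

theorem isHomogeneous_left_of_mul {F G : MvPolynomial σ R} {d : ℕ}
    (h : (F * G).IsHomogeneous d) (hF : F ≠ 0) (hG : G ≠ 0) : F.IsHomogeneous F.totalDegree := by
  have hFG : (F * G).totalDegree = d := h.totalDegree (mul_ne_zero hF hG)
  have hle := isHomogeneous_totalDegree_iff.mp (hFG ▸ h)
  rw [totalDegree_mul_of_isDomain hF hG, coe_mul, MvPowerSeries.order_mul, Nat.cast_add] at hle
  rw [isHomogeneous_totalDegree_iff]
  exact (ENat.add_le_add_iff_right (ENat.natCast_ne_top _)).mp
    (hle.trans (by gcongr; exact order_coe_le_totalDegree hG))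

end Order

section LinearSubstitution

variable {σ R : Type*} [Fintype σ] [CommRing R]

/-- The linear change of variables `F ↦ F (M Y)`. -/
noncomputable def linSubst (M : Matrix σ σ R) : MvPolynomial σ R →ₐ[R] MvPolynomial σ R :=
  aeval M.toMvPolynomial

theorem linSubst_linSubst (M N : Matrix σ σ R) (F : MvPolynomial σ R) :
    linSubst N (linSubst M F) = linSubst (M * N) F := by
  have h : (linSubst N).comp (linSubst M) = linSubst (M * N) := by
    ext j : 1
    simp only [linSubst, AlgHom.comp_apply, aeval_X, Matrix.toMvPolynomial_mul]
    rfl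
  exact DFunLike.congr_fun h F

theorem linSubst_one [DecidableEq σ] (F : MvPolynomial σ R) :
    linSubst (1 : Matrix σ σ R) F = F := by
  simp [linSubst, Matrix.toMvPolynomial_one]

theorem isHomogeneous_linSubst (M : Matrix σ σ R) {F : MvPolynomial σ R} {d : ℕ}
    (hF : F.IsHomogeneous d) : (linSubst M F).IsHomogeneous d := by
  simpa [linSubst] using hF.aeval _ M.toMvPolynomial_isHomogeneous

theorem taylor_linSubst (M : Matrix σ σ R) (v : σ → R) (F : MvPolynomial σ R) :
    taylor v (linSubst M F) = linSubst M (taylor (M.mulVec v) F) := by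
  have h : (taylor v).comp (linSubst M) = (linSubst M).comp (taylor (M.mulVec v)) := by
    ext j : 1
    simp [linSubst, taylor, Matrix.toMvPolynomial, Matrix.mulVec, dotProduct, monomial_eq, mul_add,
      Finset.sum_add_distrib]
  exact DFunLike.congr_fun h F

theorem ord_mulVec_le_ord_linSubst (M : Matrix σ σ R) (v : σ → R) (F : MvPolynomial σ R) :
    ord (M.mulVec v) F ≤ ord v (linSubst M F) := by
  rw [ord, ord, taylor_linSubst]
  exact order_coe_le_order_coe_aeval M.toMvPolynomial_constantCoeff _

theorem ord_linSubst [DecidableEq σ] {M : Matrix σ σ R} (hM : IsUnit M) (v : σ → R)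
    (F : MvPolynomial σ R) : ord v (linSubst M F) = ord (M.mulVec v) F := by
  refine le_antisymm ?_ (ord_mulVec_le_ord_linSubst M v F)
  obtain ⟨N, hMN, hNM⟩ := isUnit_iff_exists.mp hM
  simpa [linSubst_linSubst, linSubst_one, hMN, hNM] using
    ord_mulVec_le_ord_linSubst N (M.mulVec v) (linSubst M F)

theorem linSubst_injective [DecidableEq σ] {M : Matrix σ σ R} (hM : IsUnit M) :
    Function.Injective (linSubst M) := by
  obtain ⟨N, hMN, -⟩ := isUnit_iff_exists.mp hM
  exact Function.LeftInverse.injective (g := linSubst N) fun F => by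
    rw [linSubst_linSubst, hMN, linSubst_one]

theorem exists_isUnit_mulVec_eq {K : Type*} [Field K] [DecidableEq σ] {v w : σ → K} (hv : v ≠ 0)
    (hw : w ≠ 0) : ∃ M : Matrix σ σ K, IsUnit M ∧ M.mulVec v = w := by
  obtain ⟨e, he⟩ := Submodule.exists_linearEquiv_restrict_eq
    ((LinearEquiv.toSpanNonzeroSingleton K (σ → K) v hv).symm.trans
      (LinearEquiv.toSpanNonzeroSingleton K (σ → K) w hw))
  refine ⟨LinearMap.toMatrix' e.toLinearMap, ?_, ?_⟩
  · exact LinearMap.isUnit_toMatrix'_iff.mpr ((Module.End.isUnit_iff _).mpr e.bijective)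
  · rw [← Matrix.toLin'_apply, Matrix.toLin'_toMatrix']
    have h := he ⟨v, Submodule.mem_span_singleton_self v⟩
    rw [LinearEquiv.trans_apply, LinearEquiv.coord_self] at h
    simpa using h.symm

end LinearSubstitution

section Dehomogenization

variable {σ R : Type*} [CommRing R] [DecidableEq σ]

theorem aeval_update_X_monomial (i : σ) (G : MvPolynomial σ R) (s : σ →₀ ℕ) (c : R) :
    aeval (Function.update X i G) (monomial s c) = G ^ s i * monomial (s.erase i) c := by
  have h : ∀ j ∈ (s.erase i).support,
      Function.update X i G j ^ s.erase i j = X j ^ s.erase i j :=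
    fun j hj => by rw [Function.update_of_ne (by rintro rfl; simp at hj)]
  rw [aeval_monomial, ← Finsupp.mul_prod_erase' s i _ (by simp), monomial_eq,
    Finsupp.prod_congr h, Function.update_self, algebraMap_eq, mul_left_comm]

theorem coeff_aeval_update_X_one {i : σ} {F : MvPolynomial σ R} {s : σ →₀ ℕ}
    (hF : F.IsHomogeneous s.degree) :
    coeff (s.erase i) (aeval (Function.update X i 1) F : MvPolynomial σ R) = coeff s F := by
  have hinj {u : σ →₀ ℕ} (hu : u ∈ F.support) (he : u.erase i = s.erase i) : u = s := by
    have hdeg : u.degree = s.degree := (hF.degree_eq_sum_deg_support hu).symm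
    rw [← Finsupp.single_add_erase i u, ← Finsupp.single_add_erase i s, he, map_add, map_add,
      Finsupp.degree_single, Finsupp.degree_single, add_left_inj] at hdeg
    rw [← Finsupp.single_add_erase i u, ← Finsupp.single_add_erase i s, he, hdeg]
  conv_lhs => rw [F.as_sum]
  simp only [map_sum, aeval_update_X_monomial, one_pow, one_mul, coeff_sum, coeff_monomial]
  rw [Finset.sum_eq_single s (fun u hu hus => if_neg fun he => hus (hinj hu he)) (by simp)]
  simp

theorem taylor_single_one (i : σ) :
    taylor (Pi.single i 1 : σ → R) = aeval (Function.update X i (X i + 1)) := by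
  ext j : 1
  rcases eq_or_ne j i with rfl | hj
  · simp [taylor]
  · simp [taylor, hj]

theorem degree_erase_le_ord_single_monomial (i : σ) (s : σ →₀ ℕ) (c : R) :
    ((s.erase i).degree : ℕ∞) ≤ ord (Pi.single i 1) (monomial s c) := by
  rw [ord, taylor_single_one, aeval_update_X_monomial, coe_mul, coe_monomial]
  refine (le_add_left ?_).trans MvPowerSeries.le_order_mul
  exact MvPowerSeries.nat_le_order fun t ht =>
    MvPowerSeries.coeff_monomial_ne (by rintro rfl; simp at ht) c

theorem le_ord_single_iff {i : σ} {F : MvPolynomial σ R} {d : ℕ} (hF : F.IsHomogeneous d)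
    {m : ℕ} : (m : ℕ∞) ≤ ord (Pi.single i 1) F ↔ ∀ s ∈ F.support, m ≤ (s.erase i).degree := by
  refine ⟨fun h s hs => ?_, fun h => ?_⟩
  · have hdeg : F.IsHomogeneous s.degree := by
      rwa [Finsupp.degree_apply, ← hF.degree_eq_sum_deg_support hs]
    have hcomp : aeval (Function.update X i 0) (taylor (Pi.single i 1) F) =
        (aeval (Function.update X i 1) F : MvPolynomial σ R) := by
      rw [taylor_single_one, ← AlgHom.comp_apply]
      congr 1
      ext j : 1
      rcases eq_or_ne j i with rfl | hj
      · simp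
      · simp [hj]
    have hle := h.trans (order_coe_le_order_coe_aeval (f := Function.update X i 0) (fun j => ?_) _)
    · rw [hcomp, natCast_le_order_coe_iff] at hle
      by_contra! hlt
      exact mem_support_iff.mp hs (coeff_aeval_update_X_one hdeg ▸ hle _ hlt)
    · rcases eq_or_ne j i with rfl | hj
      · simp
      · simp [hj]
  · rw [← mem_vanishing, F.as_sum]
    refine Submodule.sum_mem _ fun s hs => ?_
    exact (Nat.cast_le.mpr (h s hs)).trans (degree_erase_le_ord_single_monomial i s _)

end Dehomogenization

section Dimension

variable {K : Type*} [Field K]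

theorem finrank_map_of_injective {V W : Type*} [AddCommGroup V] [Module K V] [AddCommGroup W]
    [Module K W] {f : V →ₗ[K] W} (hf : Function.Injective f) (P : Submodule K V) :
    Module.finrank K (P.map f) = Module.finrank K P :=
  (Submodule.equivMapOfInjective f hf P).finrank_eq.symm

theorem finrank_restrictSupport {σ : Type*} (S : Set (σ →₀ ℕ)) :
    Module.finrank K (restrictSupport K S) = S.ncard :=
  Module.finrank_eq_nat_card_basis (basisRestrictSupport K S)

theorem ncard_degree_eq_and_add_lt {d m : ℕ} (hm : m ≤ d + 1) :
    {s : Fin 3 →₀ ℕ | s.degree = d ∧ s 0 + s 1 < m}.ncard = (m + 1).choose 2 := by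
  have hdegree (s : Fin 3 →₀ ℕ) : s.degree = s 0 + s 1 + s 2 := by
    rw [Finsupp.degree_eq_sum, Fin.sum_univ_three]
  have hbij : Set.BijOn (fun s : Fin 3 →₀ ℕ => (⟨s 0 + s 1, s 0, s 1⟩ : Σ _ : ℕ, ℕ × ℕ))
      {s : Fin 3 →₀ ℕ | s.degree = d ∧ s 0 + s 1 < m}
      ((Finset.range m).sigma fun k => Finset.HasAntidiagonal.antidiagonal k) := by
    refine ⟨fun s hs => by simpa using hs.2, fun s hs t ht h => ?_, fun ⟨k, a, b⟩ h => ?_⟩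
    · simp only [Sigma.mk.injEq, heq_eq_eq, Prod.mk.injEq] at h
      have hs2 := hs.1
      have ht2 := ht.1
      rw [hdegree] at hs2 ht2
      ext j
      fin_cases j
      exacts [h.2.1, h.2.2, show s 2 = t 2 by omega]
    · obtain ⟨hk, rfl⟩ : k < m ∧ a + b = k := by simpa using h
      refine ⟨Finsupp.equivFunOnFinite.symm ![a, b, d - (a + b)], ⟨?_, hk⟩, rfl⟩
      rw [hdegree]
      change a + b + (d - (a + b)) = d
      omega
  rw [hbij.ncard_eq, Set.ncard_coe_finset, Finset.card_sigma, Nat.choose_two_right,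
    ← Finset.sum_range_id, Finset.sum_range_succ']
  simp

/-- The forms of degree `d` in three variables. -/
noncomputable abbrev forms (K : Type*) [Field K] (d : ℕ) : Submodule K (MvPolynomial (Fin 3) K) :=
  homogeneousSubmodule (Fin 3) K d

instance (d : ℕ) : FiniteDimensional K (forms K d) :=
  Module.Finite.iff_fg.mpr (homogeneousSubmodule_fg (σ := Fin 3) (R := K) d)

theorem forms_eq_restrictSupport (d : ℕ) : forms K d = restrictSupport K {s | s.degree = d} :=
  homogeneousSubmodule_eq_finsupp_supported _ _ _

theorem forms_inf_vanishing_single_eq_restrictSupport (d m : ℕ) :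
    forms K d ⊓ vanishing (Pi.single 2 1) m =
      restrictSupport K {s | s.degree = d ∧ m ≤ s 0 + s 1} := by
  have herase (s : Fin 3 →₀ ℕ) : (s.erase 2).degree = s 0 + s 1 := by
    simp [Finsupp.degree_eq_sum, Fin.sum_univ_three]
  ext F
  have hforms : F ∈ forms K d ↔ ∀ s ∈ F.support, s.degree = d := by
    rw [forms_eq_restrictSupport]; rfl
  rw [Submodule.mem_inf, hforms, mem_restrictSupport_iff, Set.ofPred_and, Set.subset_inter_iff]
  refine and_congr_right fun h => ?_
  rw [mem_vanishing, le_ord_single_iff ((mem_homogeneousSubmodule _ _).mp (hforms.mpr h))]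
  simp only [herase]
  rfl

theorem map_linSubst_forms_inf_vanishing {M : Matrix (Fin 3) (Fin 3) K} (hM : IsUnit M)
    (v : Fin 3 → K) (d m : ℕ) :
    (forms K d ⊓ vanishing (M.mulVec v) m).map (linSubst M).toLinearMap =
      forms K d ⊓ vanishing v m := by
  ext F
  obtain ⟨N, -, hNM⟩ := isUnit_iff_exists.mp hM
  constructor
  · rintro ⟨G, ⟨hG, hGv⟩, rfl⟩
    exact ⟨isHomogeneous_linSubst M hG, by
      simpa [mem_vanishing, ord_linSubst hM] using hGv⟩
  · rintro ⟨hF, hFv⟩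
    have hFN : linSubst M (linSubst N F) = F := by rw [linSubst_linSubst, hNM, linSubst_one]
    refine ⟨linSubst N F, ⟨isHomogeneous_linSubst N hF, ?_⟩, hFN⟩
    simpa [mem_vanishing, ← ord_linSubst hM, hFN] using hFv

theorem finrank_forms_inf_vanishing {d m : ℕ} (hm : m ≤ d + 1) {v : Fin 3 → K} (hv : v ≠ 0) :
    Module.finrank K (forms K d ⊓ vanishing v m : Submodule K (MvPolynomial (Fin 3) K))
      + (m + 1).choose 2 = Module.finrank K (forms K d) := by
  obtain ⟨M, hM, rfl⟩ := exists_isUnit_mulVec_eq (v := Pi.single 2 1) (by simp) hv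
  have hfin : {s : Fin 3 →₀ ℕ | s.degree = d}.Finite := Finsupp.finite_of_degree_eq d
  have hdiff : {s : Fin 3 →₀ ℕ | s.degree = d} \ {s | s.degree = d ∧ m ≤ s 0 + s 1} =
      {s | s.degree = d ∧ s 0 + s 1 < m} := by
    ext s
    simp only [Set.mem_sdiff, Set.mem_ofPred_eq, not_and, not_le]
    tauto
  rw [← finrank_map_of_injective (f := (linSubst M).toLinearMap) (linSubst_injective hM),
    map_linSubst_forms_inf_vanishing hM, forms_inf_vanishing_single_eq_restrictSupport,
    forms_eq_restrictSupport, finrank_restrictSupport, finrank_restrictSupport,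
    ← ncard_degree_eq_and_add_lt hm, ← hdiff, add_comm]
  exact Set.ncard_sdiff_add_ncard_of_subset (fun s hs => hs.1) hfin

theorem finrank_forms (d : ℕ) : Module.finrank K (forms K d) = (d + 2).choose 2 := by
  have hS : {s : Fin 3 →₀ ℕ | s.degree = d} = {s | s.degree = d ∧ s 0 + s 1 < d + 1} := by
    ext s
    simp only [Finsupp.degree_eq_sum, Fin.sum_univ_three, Set.mem_ofPred_eq]
    omega
  rw [forms_eq_restrictSupport, finrank_restrictSupport, hS, ncard_degree_eq_and_add_lt le_rfl]

theorem finrank_forms_le {v : Fin 3 → K} (hv : v ≠ 0) (d m : ℕ) :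
    Module.finrank K (forms K d) ≤
      Module.finrank K (forms K d ⊓ vanishing v m : Submodule K (MvPolynomial (Fin 3) K))
        + (m + 1).choose 2 := by
  rcases le_or_gt m (d + 1) with hm | hm
  · exact (finrank_forms_inf_vanishing hm hv).ge
  · rw [finrank_forms]
    exact (Nat.choose_le_choose 2 (by omega)).trans (Nat.le_add_left _ _)

end Dimension

section LinearForm

variable {σ K : Type*} [Field K]

theorem exists_isHomogeneous_one_eval_eq_eval_ne_zero [Finite σ] {v w : σ → K}
    (h : v ∉ Submodule.span K {w}) :
    ∃ ℓ : MvPolynomial σ K, ℓ.IsHomogeneous 1 ∧ eval w ℓ = 0 ∧ eval v ℓ ≠ 0 := by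
  classical
  cases nonempty_fintype σ
  obtain ⟨f, hfv, hfw⟩ := Submodule.exists_le_ker_of_notMem h
  let M : Matrix Unit σ K := LinearMap.toMatrix' (LinearMap.pi fun _ => f)
  have heval (u : σ → K) : eval u (M.toMvPolynomial ()) = f u := by
    rw [Matrix.toMvPolynomial_eval_eq_apply, LinearMap.toMatrix'_mulVec, LinearMap.pi_apply]
  refine ⟨M.toMvPolynomial (), M.toMvPolynomial_isHomogeneous (), ?_, ?_⟩
  · rw [heval]
    exact hfw (Submodule.mem_span_singleton_self w)
  · rwa [heval]

theorem rep_notMem_span_rep {P Q : ℙ K (σ → K)} (h : P ≠ Q) :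
    P.rep ∉ Submodule.span K {Q.rep} := by
  rw [Submodule.mem_span_singleton, ← Projectivization.mk_eq_mk_iff' K _ _ P.rep_nonzero
    Q.rep_nonzero, Projectivization.mk_rep, Projectivization.mk_rep]
  exact h

end LinearForm

section LinearAlgebra

variable {K V : Type*} [Field K] [AddCommGroup V] [Module K V]

theorem finrank_add_finrank_inf_le {P W : Submodule K V} [FiniteDimensional K W] (h : P ≤ W)
    (U : Submodule K V) :
    Module.finrank K P + Module.finrank K (W ⊓ U : Submodule K V) ≤
      Module.finrank K W + Module.finrank K (P ⊓ U : Submodule K V) := by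
  have := Submodule.finiteDimensional_of_le h
  have hsup := Submodule.finrank_mono (sup_le h (inf_le_left : W ⊓ U ≤ W))
  have hadd := Submodule.finrank_sup_add_finrank_inf_eq P (W ⊓ U)
  rw [← inf_assoc, inf_eq_left.mpr h] at hadd
  omega

theorem finrank_map_mulLeft {A : Type*} [Ring A] [Algebra K A] [IsDomain A] {a : A} (ha : a ≠ 0)
    (P : Submodule K A) :
    Module.finrank K (P.map (LinearMap.mulLeft K a)) = Module.finrank K P :=
  finrank_map_of_injective (fun _ _ h => mul_left_cancel₀ ha h) P

end LinearAlgebra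

section Systems

variable {K ι : Type*} [Field K]

/-- The linear system of the forms of degree `d` that vanish to order at least `m i` at `p i` for
every `i ∈ s`. -/
noncomputable def system (p : ι → ℙ K (Fin 3 → K)) (m : ι → ℕ) (s : Finset ι) (d : ℕ) :
    Submodule K (MvPolynomial (Fin 3) K) :=
  forms K d ⊓ ⨅ i ∈ s, vanishing (p i).rep (m i)

variable {p : ι → ℙ K (Fin 3 → K)} {m m' : ι → ℕ} {s : Finset ι} {d e : ℕ}

theorem mem_system {F : MvPolynomial (Fin 3) K} :
    F ∈ system p m s d ↔ F.IsHomogeneous d ∧ ∀ i ∈ s, (m i : ℕ∞) ≤ ord (p i).rep F := by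
  simp [system, Submodule.mem_iInf, mem_vanishing]

theorem system_le_forms : system p m s d ≤ forms K d := inf_le_left

instance : FiniteDimensional K (system p m s d) :=
  Submodule.finiteDimensional_of_le system_le_forms

theorem system_empty : system p m ∅ d = forms K d := by simp [system]

theorem system_insert [DecidableEq ι] {i : ι} :
    system p m (insert i s) d = system p m s d ⊓ vanishing (p i).rep (m i) := by
  rw [system, Finset.iInf_insert, system, inf_assoc, inf_comm (vanishing _ _)]

theorem mul_mem_system {F G : MvPolynomial (Fin 3) K} (hF : F ∈ system p m s d)
    (hG : G ∈ system p m' s e) : F * G ∈ system p (m + m') s (d + e) := by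
  rw [mem_system] at *
  refine ⟨hF.1.mul hG.1, fun i hi => ?_⟩
  rw [ord_mul, Pi.add_apply, Nat.cast_add]
  exact add_le_add (hF.2 i hi) (hG.2 i hi)

theorem finrank_forms_le_finrank_system_add (p : ι → ℙ K (Fin 3 → K)) (m : ι → ℕ) (s : Finset ι)
    (d : ℕ) :
    Module.finrank K (forms K d) ≤
      Module.finrank K (system p m s d) + ∑ i ∈ s, (m i + 1).choose 2 := by
  classical
  induction s using Finset.induction_on with
  | empty => rw [system_empty, Finset.sum_empty, add_zero]
  | insert i s hi ih =>
    have hforms := finrank_forms_le (p i).rep_nonzero d (m i)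
    have hinf := finrank_add_finrank_inf_le (system_le_forms (p := p) (m := m) (s := s) (d := d))
      (vanishing (p i).rep (m i))
    rw [← system_insert] at hinf
    rw [Finset.sum_insert hi]
    omega

theorem exists_mem_system_ord_eq_zero (hp : Function.Injective p) (m : ι → ℕ) {j : ι}
    (hj : j ∉ s) : ∃ G ∈ system p m s (∑ i ∈ s, m i), ord (p j).rep G = 0 := by
  have hline (i : ι) (hi : i ∈ s) : ∃ ℓ : MvPolynomial (Fin 3) K,
      ℓ.IsHomogeneous 1 ∧ eval (p i).rep ℓ = 0 ∧ eval (p j).rep ℓ ≠ 0 :=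
    exists_isHomogeneous_one_eval_eq_eval_ne_zero
      (rep_notMem_span_rep (hp.ne (by rintro rfl; exact hj hi)))
  choose! ℓ hℓ hzero hne using hline
  refine ⟨∏ i ∈ s, ℓ i ^ m i, mem_system.mpr ⟨?_, fun i hi => ?_⟩, ?_⟩
  · exact IsHomogeneous.prod _ _ _ fun i hi => by simpa using (hℓ i hi).pow (m i)
  · obtain ⟨G, hG⟩ := Finset.dvd_prod_of_mem (fun i => ℓ i ^ m i) hi
    rw [hG, ord_mul, ord_pow]
    exact le_add_right (le_mul_of_one_le_right' (one_le_ord_iff.mpr (hzero i hi)))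
  · rw [← not_ne_iff, ← Order.one_le_iff_ne_zero, one_le_ord_iff, map_prod, Finset.prod_eq_zero_iff]
    rintro ⟨i, hi, h⟩
    exact hne i hi (eq_zero_of_pow_eq_zero (by rwa [map_pow] at h))

theorem finrank_system_insert_add_le [DecidableEq ι] (hp : Function.Injective p) {i : ι}
    (hi : i ∉ s) (hd : m i + ∑ j ∈ s, m j ≤ d) :
    Module.finrank K (system p m (insert i s) d) + (m i + 1).choose 2 ≤
      Module.finrank K (system p m s d) := by
  obtain ⟨G, hG, hG0⟩ := exists_mem_system_ord_eq_zero hp m hi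
  have hGne : G ≠ 0 := by
    rintro rfl
    simp [ord_zero] at hG0
  obtain ⟨e, rfl⟩ := Nat.exists_eq_add_of_le (le_of_add_le_right hd)
  have hle : (forms K e).map (LinearMap.mulLeft K G) ≤ system p m s (∑ j ∈ s, m j + e) := by
    rintro _ ⟨F, hF, rfl⟩
    have hF' : F ∈ system p 0 s e := mem_system.mpr ⟨hF, by simp⟩
    simpa using mul_mem_system hG hF'
  have hinf : (forms K e).map (LinearMap.mulLeft K G) ⊓ vanishing (p i).rep (m i) =
      (forms K e ⊓ vanishing (p i).rep (m i)).map (LinearMap.mulLeft K G) := by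
    ext F
    constructor
    · rintro ⟨⟨F, hF, rfl⟩, hv⟩
      exact ⟨F, ⟨hF, by simpa [mem_vanishing, ord_mul, hG0] using hv⟩, rfl⟩
    · rintro ⟨F, ⟨hF, hv⟩, rfl⟩
      exact ⟨⟨F, hF, rfl⟩, by simpa [mem_vanishing, ord_mul, hG0] using hv⟩
  have hrank := finrank_add_finrank_inf_le hle (vanishing (p i).rep (m i))
  rw [← system_insert, hinf, finrank_map_mulLeft hGne, finrank_map_mulLeft hGne] at hrank
  have hforms := finrank_forms_inf_vanishing (show m i ≤ e + 1 by omega) (p i).rep_nonzero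
  omega

theorem finrank_system_add_le (hp : Function.Injective p) (hd : ∑ i ∈ s, m i ≤ d) :
    Module.finrank K (system p m s d) + ∑ i ∈ s, (m i + 1).choose 2 ≤
      Module.finrank K (forms K d) := by
  classical
  induction s using Finset.induction_on with
  | empty => rw [system_empty, Finset.sum_empty, add_zero]
  | insert i s hi ih =>
    rw [Finset.sum_insert hi] at hd ⊢
    have hinsert := finrank_system_insert_add_le hp hi hd
    have hs := ih (by omega)
    omega

theorem map_mulLeft_inf_map_mulLeft_le {F G : MvPolynomial (Fin 3) K} {a c : ℕ}
    (hF : F.IsHomogeneous a) (hF0 : F ≠ 0) (h : IsRelPrime F G)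
    (P Q : Submodule K (MvPolynomial (Fin 3) K)) (hQ : Q ≤ forms K (a + c)) :
    P.map (LinearMap.mulLeft K F) ⊓ Q.map (LinearMap.mulLeft K G) ≤
      (forms K c).map (LinearMap.mulLeft K (F * G)) := by
  rintro _ ⟨⟨A, -, rfl⟩, ⟨B, hB, hAB⟩⟩
  simp only [LinearMap.mulLeft_apply] at hAB ⊢
  obtain ⟨H, rfl⟩ : F ∣ B := h.dvd_of_dvd_mul_left (hAB ▸ dvd_mul_right F A)
  refine ⟨H, ?_, by rw [LinearMap.mulLeft_apply, ← hAB]; ring⟩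
  rcases eq_or_ne H 0 with rfl | hH0
  · exact zero_mem _
  have hFH : (F * H).IsHomogeneous (a + c) := hQ hB
  have hH := isHomogeneous_left_of_mul (mul_comm F H ▸ hFH) hH0 hF0
  have hdeg := (hF.mul hH).inj_right hFH (mul_ne_zero hF0 hH0)
  rwa [add_left_cancel hdeg] at hH

theorem choose_two_add (a b : ℕ) : (a + b).choose 2 = a.choose 2 + b.choose 2 + a * b := by
  have h : ((a + b).choose 2 : ℚ) = a.choose 2 + b.choose 2 + a * b := by
    rw [Nat.cast_choose_two, Nat.cast_choose_two, Nat.cast_choose_two]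
    push_cast
    ring
  exact_mod_cast h

theorem add_add_one_choose_two (a b : ℕ) :
    (a + b + 1).choose 2 = (a + 1).choose 2 + (b + 1).choose 2 + a * b := by
  rw [add_assoc, choose_two_add a, choose_two_add a 1, Nat.choose_succ_self 1]
  ring

/-- Bézout's inequality, obtained by comparing dimensions: among the forms of large degree with
multiplicities `m + m'`, a common multiple of `F` and `G` is a multiple of `F * G`. -/
theorem sum_mul_le_mul_of_isRelPrime (hp : Function.Injective p) {F G : MvPolynomial (Fin 3) K}
    {a b : ℕ} (hF : F ∈ system p m s a) (hG : G ∈ system p m' s b) (hF0 : F ≠ 0) (hG0 : G ≠ 0)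
    (hFG : IsRelPrime F G) : ∑ i ∈ s, m i * m' i ≤ a * b := by
  set c := ∑ i ∈ s, (m + m') i
  have hP : (system p m' s (b + c)).map (LinearMap.mulLeft K F) ≤
      system p (m + m') s (a + (b + c)) := by
    rintro _ ⟨A, hA, rfl⟩
    exact mul_mem_system hF hA
  have hQ : (system p m s (a + c)).map (LinearMap.mulLeft K G) ≤
      system p (m + m') s (a + (b + c)) := by
    rintro _ ⟨A, hA, rfl⟩
    rw [add_comm m, add_left_comm]
    exact mul_mem_system hG hA
  have hinf := Submodule.finrank_mono
    (map_mulLeft_inf_map_mulLeft_le (mem_system.mp hF).1 hF0 hFG (system p m' s (b + c))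
      (system p m s (a + c)) system_le_forms)
  have hrank := finrank_add_finrank_inf_le hP ((system p m s (a + c)).map (LinearMap.mulLeft K G))
  rw [inf_eq_right.mpr hQ] at hrank
  rw [finrank_map_mulLeft (mul_ne_zero hF0 hG0)] at hinf
  rw [finrank_map_mulLeft hF0, finrank_map_mulLeft hG0] at hrank
  have hW := finrank_system_add_le (m := m + m') (s := s) (d := a + (b + c)) hp (by omega)
  have hlowerF := finrank_forms_le_finrank_system_add p m' s (b + c)
  have hlowerG := finrank_forms_le_finrank_system_add p m s (a + c)
  have hsum : ∑ i ∈ s, ((m + m') i + 1).choose 2 = ∑ i ∈ s, (m i + 1).choose 2 +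
      ∑ i ∈ s, (m' i + 1).choose 2 + ∑ i ∈ s, m i * m' i := by
    simp only [Pi.add_apply, add_add_one_choose_two, Finset.sum_add_distrib]
  simp only [finrank_forms] at *
  have hdeg : (a + (b + c) + 2).choose 2 + (c + 2).choose 2 =
      (a + c + 2).choose 2 + (b + c + 2).choose 2 + a * b := by
    simp only [choose_two_add]
    ring
  omega

end Systems

variable {n : ℕ} {x : Fin n → Plane}

section IntersectionForm

/-- The intersection form `inter` as a bilinear form. -/
def interForm (n : ℕ) : LinearMap.BilinForm ℝ (N1 n) :=
  LinearMap.mk₂ ℝ inter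
    (fun ξ ξ' η => by
      simp only [inter, Prod.fst_add, Prod.snd_add, Pi.add_apply, add_mul, Finset.sum_add_distrib]
      ring)
    (fun c ξ η => by simp [inter, mul_sub, Finset.mul_sum, mul_assoc])
    (fun ξ η η' => by
      simp only [inter, Prod.fst_add, Prod.snd_add, Pi.add_apply, mul_add, Finset.sum_add_distrib]
      ring)
    (fun c ξ η => by simp [inter, mul_sub, Finset.mul_sum, mul_left_comm])

theorem inter_comm (ξ η : N1 n) : inter ξ η = inter η ξ := by
  simp only [inter, mul_comm]

theorem inter_add_left (ξ ξ' η : N1 n) : inter (ξ + ξ') η = inter ξ η + inter ξ' η :=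
  (interForm n).map_add₂ ξ ξ' η

theorem inter_add_right (ξ η η' : N1 n) : inter ξ (η + η') = inter ξ η + inter ξ η' :=
  (interForm n ξ).map_add η η'

theorem inter_sub_left (ξ ξ' η : N1 n) : inter (ξ - ξ') η = inter ξ η - inter ξ' η :=
  (interForm n).map_sub₂ ξ ξ' η

theorem inter_sub_right (ξ η η' : N1 n) : inter ξ (η - η') = inter ξ η - inter ξ η' :=
  (interForm n ξ).map_sub η η'

theorem inter_smul_left (c : ℝ) (ξ η : N1 n) : inter (c • ξ) η = c * inter ξ η :=
  (interForm n).map_smul₂ c ξ η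

theorem inter_smul_right (c : ℝ) (ξ η : N1 n) : inter ξ (c • η) = c * inter ξ η :=
  (interForm n ξ).map_smul c η

theorem inter_zero_right (ξ : N1 n) : inter ξ 0 = 0 := (interForm n ξ).map_zero

theorem inter_sum_right {ι : Type*} (s : Finset ι) (ξ : N1 n) (η : ι → N1 n) :
    inter ξ (∑ i ∈ s, η i) = ∑ i ∈ s, inter ξ (η i) :=
  map_sum (interForm n ξ) η s

theorem inter_sum_left {ι : Type*} (s : Finset ι) (ξ : ι → N1 n) (η : N1 n) :
    inter (∑ i ∈ s, ξ i) η = ∑ i ∈ s, inter (ξ i) η :=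
  (interForm n).map_sum₂ s ξ η

theorem inter_lineClass (ξ : N1 n) : inter ξ (lineClass n) = ξ.1 := by simp [inter, lineClass]

@[fun_prop]
theorem continuous_inter {T : Type*} [TopologicalSpace T] {f g : T → N1 n} (hf : Continuous f)
    (hg : Continuous g) : Continuous fun t => inter (f t) (g t) := by
  unfold inter
  fun_prop

/-- The inclusion of `Pic X` in `N₁(X)` as a homomorphism. -/
def Pic.toN1Hom (n : ℕ) : Pic n →+ N1 n where
  toFun := Pic.toN1
  map_zero' := by ext <;> simp [Pic.toN1]
  map_add' D D' := by ext <;> simp [Pic.toN1]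

theorem Pic.toN1_zero : (0 : Pic n).toN1 = 0 := map_zero (Pic.toN1Hom n)

theorem Pic.toN1_add (D D' : Pic n) : (D + D').toN1 = D.toN1 + D'.toN1 :=
  map_add (Pic.toN1Hom n) D D'

theorem Pic.toN1_sub (D D' : Pic n) : (D - D').toN1 = D.toN1 - D'.toN1 :=
  map_sub (Pic.toN1Hom n) D D'

theorem Pic.toN1_nsmul (k : ℕ) (D : Pic n) : (k • D).toN1 = (k : ℝ) • D.toN1 :=
  (map_nsmul (Pic.toN1Hom n) k D).trans (Nat.cast_smul_eq_nsmul ℝ k _).symm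

theorem Pic.toN1_sum {ι : Type*} (s : Finset ι) (D : ι → Pic n) :
    Pic.toN1 (∑ i ∈ s, D i) = ∑ i ∈ s, (D i).toN1 :=
  map_sum (Pic.toN1Hom n) D s

theorem Pic.toN1_injective : Function.Injective (Pic.toN1 (n := n)) := by
  intro D D' h
  ext i
  · exact Int.cast_injective (α := ℝ) (congrArg Prod.fst h)
  · exact Int.cast_injective (α := ℝ) (congrFun (congrArg Prod.snd h) i)

end IntersectionForm

section Effective

theorem vanishesToOrder_iff {F : MvPolynomial (Fin 3) ℂ} {v : Fin 3 → ℂ} {m : ℤ} :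
    VanishesToOrder F v m ↔ (m.toNat : ℕ∞) ≤ ord v F := by
  rw [ord, natCast_le_order_coe_iff]
  refine forall_congr' fun s => ?_
  rw [show ((s.degree : ℤ) < m ↔ s.degree < m.toNat) by omega]
  rfl

theorem vanishesToOrder_iff_le_mult {F : MvPolynomial (Fin 3) ℂ} (hF : F ≠ 0) {v : Fin 3 → ℂ}
    {m : ℤ} : VanishesToOrder F v m ↔ m ≤ mult v F := by
  rw [vanishesToOrder_iff, ← natCast_mult hF, Nat.cast_le]
  exact Int.toNat_le

theorem isEffective_iff_exists_le_mult {D : Pic n} : IsEffective x D ↔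
    ∃ (F : MvPolynomial (Fin 3) ℂ) (d : ℕ), F.IsHomogeneous d ∧ F ≠ 0 ∧ (d : ℤ) = D.1 ∧
      ∀ i, D.2 i ≤ mult (x i).rep F := by
  constructor
  · rintro ⟨F, ⟨⟨d, hd, hF⟩, hm⟩, hF0⟩
    exact ⟨F, d, hF, hF0, hd, fun i => (vanishesToOrder_iff_le_mult hF0).mp (hm i)⟩
  · rintro ⟨F, d, hF, hF0, hd, hm⟩
    exact ⟨F, ⟨⟨d, hd, hF⟩, fun i => (vanishesToOrder_iff_le_mult hF0).mpr (hm i)⟩, hF0⟩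

theorem isEffective_iff_system_ne_bot {D : Pic n} {d : ℕ} (hd : D.1 = d) :
    IsEffective x D ↔ system x (fun i => (D.2 i).toNat) Finset.univ d ≠ ⊥ := by
  simp only [IsEffective, linearSystem, Set.mem_ofPred_eq, hd, Nat.cast_inj, exists_eq_left,
    vanishesToOrder_iff, Submodule.ne_bot_iff, mem_system, Finset.mem_univ, true_implies]

variable (x) in
/-- The monoid of the effective classes. -/
def effectiveMonoid : AddSubmonoid (Pic n) where
  carrier := {D | IsEffective x D}
  zero_mem' := isEffective_iff_exists_le_mult.mpr
    ⟨1, 0, isHomogeneous_one _ _, one_ne_zero, rfl, by simp⟩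
  add_mem' {D D'} hD hD' := by
    obtain ⟨F, d, hF, hF0, hd, hm⟩ := isEffective_iff_exists_le_mult.mp hD
    obtain ⟨F', d', hF', hF0', hd', hm'⟩ := isEffective_iff_exists_le_mult.mp hD'
    refine isEffective_iff_exists_le_mult.mpr
      ⟨F * F', d + d', hF.mul hF', mul_ne_zero hF0 hF0', by simp [hd, hd'], fun i => ?_⟩
    rw [mult_mul hF0 hF0', Nat.cast_add]
    exact add_le_add (hm i) (hm' i)

theorem mem_effectiveMonoid {D : Pic n} : D ∈ effectiveMonoid x ↔ IsEffective x D := Iff.rfl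

theorem isEffective_zero : IsEffective x 0 := zero_mem (effectiveMonoid x)

theorem IsEffective.add {D D' : Pic n} (hD : IsEffective x D) (hD' : IsEffective x D') :
    IsEffective x (D + D') :=
  (effectiveMonoid x).add_mem hD hD'

theorem IsEffective.nsmul {D : Pic n} (hD : IsEffective x D) (k : ℕ) : IsEffective x (k • D) :=
  (effectiveMonoid x).nsmul_mem hD k

theorem IsEffective.sum {ι : Type*} {s : Finset ι} {D : ι → Pic n}
    (hD : ∀ i ∈ s, IsEffective x (D i)) : IsEffective x (∑ i ∈ s, D i) :=
  (effectiveMonoid x).sum_mem hD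

theorem IsEffective.degree_nonneg {D : Pic n} (hD : IsEffective x D) : 0 ≤ D.1 := by
  obtain ⟨F, d, -, -, hd, -⟩ := isEffective_iff_exists_le_mult.mp hD
  exact hd ▸ Int.natCast_nonneg d

theorem IsEffective.le_degree {D : Pic n} (hD : IsEffective x D) (i : Fin n) : D.2 i ≤ D.1 := by
  obtain ⟨F, d, hF, hF0, hd, hm⟩ := isEffective_iff_exists_le_mult.mp hD
  have hle := ord_le_of_isHomogeneous hF hF0 (x i).rep
  rw [← natCast_mult hF0, Nat.cast_le] at hle
  exact (hm i).trans (hd ▸ Nat.cast_le.mpr hle)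

theorem natCast_toNat_add_one_choose_two_le (m : ℤ) :
    (((m.toNat + 1).choose 2 : ℕ) : ℝ) ≤ (m : ℝ) * (m + 1) / 2 := by
  rcases le_or_gt 0 m with hm | hm
  · lift m to ℕ using hm
    rw [Nat.cast_choose_two, Int.toNat_natCast]
    push_cast
    linarith
  · have hm1 : (m : ℝ) ≤ -1 := by exact_mod_cast Int.le_sub_one_of_lt hm
    rw [Int.toNat_of_nonpos hm.le, Nat.choose_eq_zero_of_lt (by simp), Nat.cast_zero]
    nlinarith

theorem sum_choose_two_lt_of_inter_canonicalClass_le {D : Pic n} {d : ℕ} (hd : D.1 = d)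
    (h : inter D.toN1 (canonicalClass n) ≤ inter D.toN1 D.toN1) :
    ∑ i, ((D.2 i).toNat + 1).choose 2 < (d + 2).choose 2 := by
  have hsum : ∑ i, (D.2 i : ℝ) * (D.2 i + 1) / 2 ≤ (d : ℝ) * (d + 3) / 2 := by
    simp only [inter, canonicalClass, Pic.toN1, hd, mul_neg, mul_one, Finset.sum_neg_distrib,
      Int.cast_natCast] at h
    simp only [← Finset.sum_div, mul_add, mul_one, Finset.sum_add_distrib]
    linarith
  rw [← Nat.cast_lt (α := ℝ)]
  calc ((∑ i, ((D.2 i).toNat + 1).choose 2 : ℕ) : ℝ)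
      = ∑ i, (((D.2 i).toNat + 1).choose 2 : ℝ) := by push_cast; rfl
    _ ≤ ∑ i, (D.2 i : ℝ) * (D.2 i + 1) / 2 :=
      Finset.sum_le_sum fun i _ => natCast_toNat_add_one_choose_two_le (D.2 i)
    _ ≤ (d : ℝ) * (d + 3) / 2 := hsum
    _ < ((d + 2).choose 2 : ℕ) := by
      rw [Nat.cast_choose_two]
      push_cast
      linarith

/-- Riemann–Roch together with the vanishing of `h²`: `h⁰(D) ≥ 1 + (D² - D · K) / 2 > 0`. -/
theorem isEffective_of_inter_canonicalClass_le {D : Pic n} (hD : 0 ≤ D.1)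
    (h : inter D.toN1 (canonicalClass n) ≤ inter D.toN1 D.toN1) : IsEffective x D := by
  obtain ⟨d, hd⟩ := Int.eq_ofNat_of_zero_le hD
  rw [isEffective_iff_system_ne_bot hd]
  intro hbot
  have hcount := finrank_forms_le_finrank_system_add x (fun i => (D.2 i).toNat) Finset.univ d
  rw [hbot, finrank_bot, zero_add, finrank_forms] at hcount
  exact hcount.not_gt (sum_choose_two_lt_of_inter_canonicalClass_le hd h)

variable (x) in
/-- A class in `Pic X` is ℚ-effective if one of its positive multiples is effective. -/
def IsQEffective (D : Pic n) : Prop := ∃ k : ℕ, 0 < k ∧ IsEffective x (k • D)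

theorem IsEffective.isQEffective {D : Pic n} (hD : IsEffective x D) : IsQEffective x D :=
  ⟨1, one_pos, by rwa [one_nsmul]⟩

theorem IsQEffective.add {D D' : Pic n} (hD : IsQEffective x D) (hD' : IsQEffective x D') :
    IsQEffective x (D + D') := by
  obtain ⟨k, hk, hkD⟩ := hD
  obtain ⟨k', hk', hkD'⟩ := hD'
  refine ⟨k * k', Nat.mul_pos hk hk', ?_⟩
  rw [nsmul_add, mul_nsmul, mul_comm, mul_nsmul]
  exact (hkD.nsmul k').add (hkD'.nsmul k)

theorem IsQEffective.of_nsmul {D : Pic n} {k : ℕ} (hk : 0 < k) (hD : IsQEffective x (k • D)) :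
    IsQEffective x D := by
  obtain ⟨l, hl, hlD⟩ := hD
  exact ⟨k * l, Nat.mul_pos hk hl, by rwa [mul_nsmul]⟩

theorem isQEffective_of_inter_self_pos {D : Pic n} (hD : 0 ≤ D.1)
    (hD2 : 0 < inter D.toN1 D.toN1) : IsQEffective x D := by
  obtain ⟨k, hk⟩ := exists_nat_ge
    (max 1 (inter D.toN1 (canonicalClass n) / inter D.toN1 D.toN1))
  have hk1 : (1 : ℝ) ≤ k := (le_max_left _ _).trans hk
  have hkD : inter D.toN1 (canonicalClass n) ≤ k * inter D.toN1 D.toN1 :=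
    (div_le_iff₀ hD2).mp ((le_max_right _ _).trans hk)
  refine ⟨k, by exact_mod_cast hk1, isEffective_of_inter_canonicalClass_le ?_ ?_⟩
  · rw [Prod.smul_fst, nsmul_eq_mul]
    exact mul_nonneg (Int.natCast_nonneg k) hD
  · simp only [Pic.toN1_nsmul, inter_smul_left, inter_smul_right]
    exact mul_le_mul_of_nonneg_left hkD (by positivity)

end Effective

section Curves

variable (x) in
/-- The class of the strict transform of the plane curve `F = 0`. -/
noncomputable def formClass (F : MvPolynomial (Fin 3) ℂ) : Pic n :=
  (F.totalDegree, fun i => mult (x i).rep F)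

/-- The class of the exceptional curve over the `i`-th point. -/
def exceptional (i : Fin n) : Pic n := (0, -Pi.single i 1)

variable (x) in
/-- The classes of the irreducible curves: the strict transforms of irreducible plane curves and
the exceptional curves. -/
def IsCurve (C : Pic n) : Prop :=
  (∃ F, Irreducible F ∧ F.IsHomogeneous F.totalDegree ∧ C = formClass x F) ∨
    ∃ i, C = exceptional i

theorem formClass_mul {F G : MvPolynomial (Fin 3) ℂ} (hF : F ≠ 0) (hG : G ≠ 0) :
    formClass x (F * G) = formClass x F + formClass x G := by
  ext i
  · simp [formClass, totalDegree_mul_of_isDomain hF hG]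
  · simp [formClass, mult_mul hF hG]

theorem formClass_eq_zero_iff {F : MvPolynomial (Fin 3) ℂ} (hF : F ≠ 0) :
    formClass x F = 0 ↔ IsUnit F := by
  constructor
  · intro h
    have hdeg : F.totalDegree = 0 := Int.natCast_eq_zero.mp (congrArg Prod.fst h)
    rw [totalDegree_eq_zero_iff_eq_C] at hdeg
    rw [hdeg] at hF ⊢
    exact (isUnit_iff_ne_zero.mpr fun h0 => hF (by rw [h0, C_0])).map C
  · intro h
    obtain ⟨c, -, rfl⟩ := isUnit_iff_eq_C_of_isReduced.mp h
    ext i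
    · simp [formClass]
    · have hord := ord_le_of_isHomogeneous (isHomogeneous_C (Fin 3) c) hF (x i).rep
      rw [← natCast_mult hF] at hord
      simpa [formClass] using hord

theorem inter_exceptional (ξ : N1 n) (i : Fin n) : inter ξ (exceptional i).toN1 = ξ.2 i := by
  simp [inter, exceptional, Pic.toN1, Pi.single_apply]

theorem isEffective_formClass {F : MvPolynomial (Fin 3) ℂ} (hF : F ≠ 0)
    (hFd : F.IsHomogeneous F.totalDegree) : IsEffective x (formClass x F) :=
  isEffective_iff_exists_le_mult.mpr ⟨F, _, hFd, hF, rfl, fun _ => le_rfl⟩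

theorem isEffective_exceptional (i : Fin n) : IsEffective x (exceptional i) :=
  isEffective_iff_exists_le_mult.mpr ⟨1, 0, isHomogeneous_one _ _, one_ne_zero, rfl, fun j => by
    simp only [exceptional, Pi.neg_apply, Pi.single_apply]
    split_ifs <;> omega⟩

theorem IsCurve.isEffective {C : Pic n} (hC : IsCurve x C) : IsEffective x C := by
  rcases hC with ⟨F, hF, hFd, rfl⟩ | ⟨i, rfl⟩
  · exact isEffective_formClass hF.ne_zero hFd
  · exact isEffective_exceptional i

theorem IsCurve.ne_zero {C : Pic n} (hC : IsCurve x C) : C ≠ 0 := by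
  rcases hC with ⟨F, hF, -, rfl⟩ | ⟨i, rfl⟩
  · exact fun h => hF.not_isUnit ((formClass_eq_zero_iff hF.ne_zero).mp h)
  · intro h
    simpa [exceptional] using congrFun (congrArg Prod.snd h) i

theorem IsCurve.inter_nonneg (hx : Function.Injective x) {C C' : Pic n} (hC : IsCurve x C)
    (hC' : IsCurve x C') (hne : C ≠ C') : 0 ≤ inter C.toN1 C'.toN1 := by
  rcases hC with ⟨F, hF, hFd, rfl⟩ | ⟨i, rfl⟩
  · rcases hC' with ⟨G, hG, hGd, rfl⟩ | ⟨j, rfl⟩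
    · have hFG : IsRelPrime F G := hF.isRelPrime_iff_not_dvd.mpr fun hdvd => hne <| by
        obtain ⟨u, rfl⟩ := hF.associated_of_dvd hG hdvd
        rw [formClass_mul hF.ne_zero u.ne_zero,
          (formClass_eq_zero_iff u.ne_zero).mpr u.isUnit, add_zero]
      have hbezout := sum_mul_le_mul_of_isRelPrime (s := Finset.univ) hx
        (mem_system.mpr ⟨hFd, fun i _ => (natCast_mult hF.ne_zero _).le⟩)
        (mem_system.mpr ⟨hGd, fun i _ => (natCast_mult hG.ne_zero _).le⟩)
        hF.ne_zero hG.ne_zero hFG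
      simp only [inter, formClass, Pic.toN1, Int.cast_natCast]
      exact sub_nonneg.mpr (by exact_mod_cast hbezout)
    · rw [inter_exceptional]
      simp [Pic.toN1, formClass]
  · rw [inter_comm, inter_exceptional]
    rcases hC' with ⟨G, -, -, rfl⟩ | ⟨j, rfl⟩
    · simp [Pic.toN1, formClass]
    · have hij : i ≠ j := fun h => hne (h ▸ rfl)
      simp [Pic.toN1, exceptional, Pi.single_apply, hij]

theorem formClass_mem_closure_isCurve {F : MvPolynomial (Fin 3) ℂ} (hF : F ≠ 0)
    (hFd : F.IsHomogeneous F.totalDegree) :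
    formClass x F ∈ AddSubmonoid.closure {C | IsCurve x C} := by
  induction F using WfDvdMonoid.induction_on_irreducible with
  | zero => exact absurd rfl hF
  | unit u hu => exact (formClass_eq_zero_iff hF).mpr hu ▸ zero_mem _
  | mul G P hG hP ih =>
    have hGd := isHomogeneous_left_of_mul (mul_comm P G ▸ hFd) hG hP.ne_zero
    have hPd := isHomogeneous_left_of_mul hFd hP.ne_zero hG
    rw [formClass_mul hP.ne_zero hG]
    exact add_mem (AddSubmonoid.mem_closure_of_mem (Or.inl ⟨P, hP, hPd, rfl⟩)) (ih hG hGd)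

theorem eq_formClass_add_sum_exceptional {D : Pic n} {F : MvPolynomial (Fin 3) ℂ}
    (hd : (F.totalDegree : ℤ) = D.1) (hm : ∀ i, D.2 i ≤ mult (x i).rep F) :
    D = formClass x F + ∑ i, (mult (x i).rep F - D.2 i).toNat • exceptional i := by
  ext j
  · simp [formClass, exceptional, Prod.fst_sum, hd]
  · simp [formClass, exceptional, Prod.snd_sum, Finset.sum_apply, Pi.single_apply, hm]

variable (x) in
theorem closure_isCurve : AddSubmonoid.closure {C | IsCurve x C} = effectiveMonoid x := by
  refine le_antisymm (AddSubmonoid.closure_le.mpr fun C hC => hC.isEffective) fun D hD => ?_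
  obtain ⟨F, d, hF, hF0, hd, hm⟩ := isEffective_iff_exists_le_mult.mp hD
  obtain rfl := hF.totalDegree hF0
  rw [eq_formClass_add_sum_exceptional hd hm]
  have hexceptional (i : Fin n) : exceptional i ∈ AddSubmonoid.closure {C | IsCurve x C} :=
    AddSubmonoid.mem_closure_of_mem (Or.inr ⟨i, rfl⟩)
  exact add_mem (formClass_mem_closure_isCurve hF0 hF)
    (sum_mem fun i _ => nsmul_mem (hexceptional i) _)

theorem mem_nefCone_of_forall_isCurve {ξ : N1 n} (h : ∀ C, IsCurve x C → 0 ≤ inter ξ C.toN1) :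
    ξ ∈ nefCone x := by
  intro D hD
  rw [← mem_effectiveMonoid, ← closure_isCurve] at hD
  induction hD using AddSubmonoid.closure_induction with
  | mem C hC => exact h C hC
  | zero => rw [Pic.toN1_zero, inter_zero_right]
  | add D D' _ _ ih ih' =>
    rw [Pic.toN1_add, inter_add_right]
    exact add_nonneg ih ih'

theorem IsCurve.exists_isEffective_sub (hx : Function.Injective x) {C D : Pic n}
    (hC : IsCurve x C) (hD : IsEffective x D) :
    ∃ k : ℕ, IsEffective x (D - k • C) ∧ 0 ≤ inter C.toN1 (D - k • C).toN1 := by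
  rw [← mem_effectiveMonoid, ← closure_isCurve] at hD
  induction hD using AddSubmonoid.closure_induction with
  | mem C' hC' =>
    obtain rfl | hne := eq_or_ne C C'
    · exact ⟨1, by simp [isEffective_zero], by simp [Pic.toN1_zero, inter_zero_right]⟩
    · exact ⟨0, by simpa using hC'.isEffective, by simpa using hC.inter_nonneg hx hC' hne⟩
  | zero => exact ⟨0, by simp [isEffective_zero], by simp [Pic.toN1_zero, inter_zero_right]⟩
  | add D D' _ _ ih ih' =>
    obtain ⟨k, hk, hCk⟩ := ih
    obtain ⟨k', hk', hCk'⟩ := ih'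
    refine ⟨k + k', ?_, ?_⟩
    · rw [add_nsmul, add_sub_add_comm]
      exact hk.add hk'
    · rw [add_nsmul, add_sub_add_comm, Pic.toN1_add, inter_add_right]
      exact add_nonneg hCk hCk'

end Curves

section Cones

theorem isClosed_moriCone : IsClosed (moriCone x) := isClosed_closure

/-- The class of a line as an element of `Pic X`. -/
def linePic (n : ℕ) : Pic n := (1, 0)

theorem isEffective_linePic : IsEffective x (linePic n) :=
  isEffective_iff_exists_le_mult.mpr ⟨MvPolynomial.X 0, 1, MvPolynomial.isHomogeneous_X ℂ 0,
    MvPolynomial.X_ne_zero 0, rfl, by simp [linePic]⟩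

theorem linePic_ne_zero : linePic n ≠ 0 := fun h => one_ne_zero (congrArg Prod.fst h)

theorem toN1_linePic : (linePic n).toN1 = lineClass n := by
  ext <;> simp [linePic, lineClass, Pic.toN1]

theorem moriCone_subset_of_isClosed {S : Set (N1 n)} (hS : IsClosed S)
    (h : ∀ D : Pic n, IsEffective x D → ∀ c : ℝ, 0 < c → c • D.toN1 ∈ S) : moriCone x ⊆ S := by
  refine closure_minimal ?_ hS
  rintro _ ⟨_, ⟨D, -, hD, rfl⟩, c, hc, rfl⟩
  exact h D hD c hc

theorem smul_toN1_mem_moriCone_of_ne_zero {D : Pic n} (hD : IsEffective x D) (hD0 : D ≠ 0) {c : ℝ}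
    (hc : 0 < c) : c • D.toN1 ∈ moriCone x :=
  subset_closure ⟨ray D.toN1, ⟨D, hD0, hD, rfl⟩, c, hc, rfl⟩

theorem zero_mem_moriCone : (0 : N1 n) ∈ moriCone x := by
  have hlim : Tendsto (fun k : ℕ => (1 / ((k : ℝ) + 1)) • (linePic n).toN1) atTop
      (𝓝 ((0 : ℝ) • (linePic n).toN1)) :=
    tendsto_one_div_add_atTop_nhds_zero_nat.smul_const _
  rw [zero_smul] at hlim
  exact isClosed_moriCone.mem_of_tendsto hlim <| Eventually.of_forall fun k =>
    smul_toN1_mem_moriCone_of_ne_zero isEffective_linePic linePic_ne_zero (by positivity)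

theorem smul_toN1_mem_moriCone {D : Pic n} (hD : IsEffective x D) {c : ℝ} (hc : 0 ≤ c) :
    c • D.toN1 ∈ moriCone x := by
  obtain rfl | hc := hc.eq_or_lt
  · rw [zero_smul]
    exact zero_mem_moriCone
  obtain rfl | hD0 := eq_or_ne D 0
  · rw [Pic.toN1_zero, smul_zero]
    exact zero_mem_moriCone
  · exact smul_toN1_mem_moriCone_of_ne_zero hD hD0 hc

theorem smul_toN1_add_smul_toN1_mem_moriCone {D D' : Pic n} (hD : IsEffective x D)
    (hD' : IsEffective x D') {c c' : ℝ} (hc : 0 ≤ c) (hc' : 0 ≤ c') :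
    c • D.toN1 + c' • D'.toN1 ∈ moriCone x := by
  have hlim : Tendsto
      (fun t : ℝ => ((⌈c * t⌉₊ : ℝ) / t) • D.toN1 + ((⌈c' * t⌉₊ : ℝ) / t) • D'.toN1) atTop
      (𝓝 (c • D.toN1 + c' • D'.toN1)) :=
    ((tendsto_nat_ceil_mul_div_atTop hc).smul_const D.toN1).add
      ((tendsto_nat_ceil_mul_div_atTop hc').smul_const D'.toN1)
  refine isClosed_moriCone.mem_of_tendsto hlim ?_
  filter_upwards [eventually_gt_atTop 0] with t ht
  have hmem := smul_toN1_mem_moriCone ((hD.nsmul ⌈c * t⌉₊).add (hD'.nsmul ⌈c' * t⌉₊))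
    (inv_nonneg.mpr ht.le)
  rwa [Pic.toN1_add, Pic.toN1_nsmul, Pic.toN1_nsmul, smul_add, smul_smul, smul_smul,
    ← div_eq_inv_mul, ← div_eq_inv_mul] at hmem

theorem inter_nonneg_of_mem_nefCone {η α : N1 n} (hη : η ∈ nefCone x) (hα : α ∈ moriCone x) :
    0 ≤ inter η α := by
  have hclosed : IsClosed {α : N1 n | 0 ≤ inter η α} :=
    isClosed_le continuous_const (by fun_prop)
  refine moriCone_subset_of_isClosed hclosed (fun D hD c hc => ?_) hα
  rw [Set.mem_ofPred_eq, inter_smul_right]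
  exact mul_nonneg hc.le (hη D hD)

theorem smul_mem_nefCone {η : N1 n} (hη : η ∈ nefCone x) {c : ℝ} (hc : 0 ≤ c) :
    c • η ∈ nefCone x := fun D hD => by
  rw [inter_smul_left]
  exact mul_nonneg hc (hη D hD)

theorem lineClass_mem_nefCone : lineClass n ∈ nefCone x := fun D hD => by
  rw [inter_comm, inter_lineClass]
  exact Int.cast_nonneg hD.degree_nonneg

theorem fst_nonneg_of_mem_moriCone {α : N1 n} (hα : α ∈ moriCone x) : 0 ≤ α.1 := by
  rw [← inter_lineClass, inter_comm]
  exact inter_nonneg_of_mem_nefCone lineClass_mem_nefCone hα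

/-- The class `(n + 1) L - ∑ i, E i`, which is positive on the nonzero effective classes. -/
def ampleClass (n : ℕ) : N1 n := (n + 1, fun _ => 1)

theorem inter_ampleClass (D : Pic n) :
    inter (ampleClass n) D.toN1 = ((D.1 + ∑ i, (D.1 - D.2 i) : ℤ) : ℝ) := by
  simp only [inter, ampleClass, Pic.toN1, one_mul, Finset.sum_sub_distrib, Finset.sum_const,
    Finset.card_univ, Fintype.card_fin, nsmul_eq_mul, Int.cast_add, Int.cast_sub, Int.cast_mul,
    Int.cast_natCast, Int.cast_sum]
  ring

theorem inter_ampleClass_pos {D : Pic n} (hD : IsEffective x D) (hD0 : D ≠ 0) :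
    0 < inter (ampleClass n) D.toN1 := by
  have hdiff : ∀ i ∈ Finset.univ, 0 ≤ D.1 - D.2 i := fun i _ => sub_nonneg.mpr (hD.le_degree i)
  rw [inter_ampleClass, Int.cast_pos]
  refine lt_of_le_of_ne (add_nonneg hD.degree_nonneg (Finset.sum_nonneg hdiff)) fun h => hD0 ?_
  obtain ⟨hdegree, hsum⟩ :=
    (add_eq_zero_iff_of_nonneg hD.degree_nonneg (Finset.sum_nonneg hdiff)).mp h.symm
  ext i
  · exact hdegree
  · have := (Finset.sum_eq_zero_iff_of_nonneg hdiff).mp hsum i (Finset.mem_univ i)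
    rwa [hdegree, zero_sub, neg_eq_zero] at this

theorem ampleClass_mem_nefCone : ampleClass n ∈ nefCone x := fun D hD => by
  obtain rfl | hD0 := eq_or_ne D 0
  · rw [Pic.toN1_zero, inter_zero_right]
  · exact (inter_ampleClass_pos hD hD0).le

theorem IsCurve.toN1_mem_nefCone (hx : Function.Injective x) {C : Pic n} (hC : IsCurve x C)
    (hCC : 0 ≤ inter C.toN1 C.toN1) : C.toN1 ∈ nefCone x :=
  mem_nefCone_of_forall_isCurve fun C' hC' => by
    obtain rfl | hne := eq_or_ne C C'
    · exact hCC
    · exact hC.inter_nonneg hx hC' hne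

theorem IsCurve.inter_self_neg (hx : Function.Injective x) {C : Pic n} (hC : IsCurve x C)
    {α : N1 n} (hα : α ∈ moriCone x) (hαC : inter α C.toN1 < 0) : inter C.toN1 C.toN1 < 0 := by
  by_contra! hCC
  exact hαC.not_ge (inter_comm α _ ▸ inter_nonneg_of_mem_nefCone (hC.toN1_mem_nefCone hx hCC) hα)

theorem IsCurve.sub_max_smul_mem_moriCone (hx : Function.Injective x) {C : Pic n}
    (hC : IsCurve x C) (hCC : inter C.toN1 C.toN1 < 0) {α : N1 n} (hα : α ∈ moriCone x) :
    α - max (inter α C.toN1 / inter C.toN1 C.toN1) 0 • C.toN1 ∈ moriCone x := by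
  refine moriCone_subset_of_isClosed
    (S := (fun α => α - max (inter α C.toN1 / inter C.toN1 C.toN1) 0 • C.toN1) ⁻¹' moriCone x)
    (isClosed_moriCone.preimage (by fun_prop)) (fun D hD c hc => ?_) hα
  obtain ⟨k, hDk, hCk⟩ := hC.exists_isEffective_sub hx hD
  set r := max (inter D.toN1 C.toN1 / inter C.toN1 C.toN1) 0
  have hr : r ≤ k := by
    refine max_le ?_ k.cast_nonneg
    rw [div_le_iff_of_neg hCC]
    rwa [Pic.toN1_sub, Pic.toN1_nsmul, inter_sub_right, inter_smul_right, inter_comm, sub_nonneg]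
      at hCk
  have hcr : max (inter (c • D.toN1) C.toN1 / inter C.toN1 C.toN1) 0 = c * r := by
    rw [inter_smul_left, mul_div_assoc, mul_max_of_nonneg _ _ hc.le, mul_zero]
  have hdecomp : c • D.toN1 - (c * r) • C.toN1 =
      c • (D - k • C).toN1 + (c * (k - r)) • C.toN1 := by
    rw [Pic.toN1_sub, Pic.toN1_nsmul]
    module
  rw [Set.mem_preimage, hcr, hdecomp]
  exact smul_toN1_add_smul_toN1_mem_moriCone hDk hC.isEffective hc.le
    (mul_nonneg hc.le (sub_nonneg.mpr hr))

end Cones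

section NonnegCone

theorem exists_intCast_eq_natCast_mul {q : ℚ} {N : ℕ} (h : q.den ∣ N) :
    ∃ z : ℤ, (z : ℝ) = N * q := by
  obtain ⟨k, rfl⟩ := h
  have hnum : (q : ℝ) * q.den = q.num := by exact_mod_cast q.mul_den_eq_num
  refine ⟨k * q.num, ?_⟩
  push_cast
  rw [← hnum]
  ring

theorem IsRational.exists_toN1_eq {ξ : N1 n} (hξ : IsRational ξ) :
    ∃ (N : ℕ) (D : Pic n), 0 < N ∧ D.toN1 = (N : ℝ) • ξ := by
  obtain ⟨⟨q, hq⟩, h⟩ := hξ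
  choose r hr using h
  set N := q.den * ∏ i, (r i).den
  have hrN (i : Fin n) : (r i).den ∣ N :=
    (Finset.dvd_prod_of_mem (fun i => (r i).den) (Finset.mem_univ i)).mul_left q.den
  obtain ⟨d, hd⟩ := exists_intCast_eq_natCast_mul (dvd_mul_right q.den (∏ i, (r i).den))
  choose m hm using fun i => exists_intCast_eq_natCast_mul (hrN i)
  refine ⟨N, (d, m), Nat.mul_pos q.den_pos (Finset.prod_pos fun i _ => (r i).den_pos), ?_⟩
  ext i
  · simp only [Pic.toN1, hd, hq, Prod.smul_fst, smul_eq_mul, N]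
  · simp only [Pic.toN1, hm, hr, Prod.smul_snd, Pi.smul_apply, smul_eq_mul]

theorem dense_setOf_isRational : Dense {ξ : N1 n | IsRational ξ} := by
  have h : DenseRange (Prod.map ((↑) : ℚ → ℝ) (Pi.map fun _ : Fin n => ((↑) : ℚ → ℝ))) :=
    Rat.denseRange_cast.prodMap (DenseRange.piMap fun _ => Rat.denseRange_cast)
  refine h.mono ?_
  rintro _ ⟨q, rfl⟩
  exact ⟨⟨q.1, rfl⟩, fun i => ⟨q.2 i, rfl⟩⟩

/-- The positive cone: `ξ · L > 0` and `ξ² > 0`. -/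
def positiveCone (n : ℕ) : Set (N1 n) := {ξ | 0 < ξ.1 ∧ 0 < inter ξ ξ}

theorem isOpen_positiveCone : IsOpen (positiveCone n) :=
  IsOpen.and (isOpen_lt continuous_const continuous_fst)
    (isOpen_lt continuous_const (by fun_prop))

theorem isClosed_nonnegCone : IsClosed (nonnegCone n) :=
  IsClosed.and (isClosed_le continuous_const (by fun_prop))
    (isClosed_le continuous_const (by fun_prop))

theorem positiveCone_subset_nonnegCone : positiveCone n ⊆ nonnegCone n := fun ξ hξ =>
  ⟨inter_lineClass ξ ▸ hξ.1.le, hξ.2.le⟩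

theorem nonnegCone_subset_closure_positiveCone : nonnegCone n ⊆ closure (positiveCone n) := by
  rintro ξ ⟨hξL, hξξ⟩
  have hlim : Tendsto (fun k : ℕ => ξ + (1 / ((k : ℝ) + 1)) • lineClass n) atTop
      (𝓝 (ξ + (0 : ℝ) • lineClass n)) :=
    (tendsto_one_div_add_atTop_nhds_zero_nat.smul_const _).const_add ξ
  rw [zero_smul, add_zero] at hlim
  refine mem_closure_of_tendsto hlim (Eventually.of_forall fun k => ?_)
  have hε : 0 < 1 / ((k : ℝ) + 1) := by positivity
  set ε := 1 / ((k : ℝ) + 1)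
  have hLL : inter (lineClass n) (lineClass n) = 1 := inter_lineClass _
  constructor
  · rw [← inter_lineClass, inter_add_left, inter_smul_left, hLL]
    linarith
  · have hsquare : inter (ξ + ε • lineClass n) (ξ + ε • lineClass n) =
        inter ξ ξ + 2 * (ε * inter ξ (lineClass n)) + ε ^ 2 := by
      simp only [inter_add_left, inter_add_right, inter_smul_left, inter_smul_right, hLL,
        inter_comm (lineClass n) ξ]
      ring
    rw [hsquare]
    positivity

theorem mem_moriCone_of_isRational {ξ : N1 n} (hξ : IsRational ξ) (hpos : ξ ∈ positiveCone n) :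
    ξ ∈ moriCone x := by
  obtain ⟨N, D, hN, hD⟩ := hξ.exists_toN1_eq
  have hD1 : 0 ≤ D.1 := by
    have : (D.1 : ℝ) = N * ξ.1 := congrArg Prod.fst hD
    exact_mod_cast this ▸ mul_nonneg N.cast_nonneg hpos.1.le
  have hDD : 0 < inter D.toN1 D.toN1 := by
    have := hpos.2
    rw [hD, inter_smul_left, inter_smul_right]
    positivity
  obtain ⟨k, hk, hkD⟩ := isQEffective_of_inter_self_pos (x := x) hD1 hDD
  have hmem := smul_toN1_mem_moriCone hkD (c := ((k : ℝ) * N)⁻¹) (by positivity)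
  rwa [Pic.toN1_nsmul, hD, smul_smul (k : ℝ), inv_smul_smul₀ (by positivity)] at hmem

theorem nonnegCone_subset_moriCone : nonnegCone n ⊆ moriCone x :=
  calc nonnegCone n
      ⊆ closure (positiveCone n) := nonnegCone_subset_closure_positiveCone
    _ ⊆ closure (positiveCone n ∩ {ξ | IsRational ξ}) :=
      closure_minimal (dense_setOf_isRational.open_subset_closure_inter isOpen_positiveCone)
        isClosed_closure
    _ ⊆ moriCone x := closure_minimal (fun _ hξ => mem_moriCone_of_isRational hξ.2 hξ.1)
      isClosed_moriCone

theorem nefCone_subset_nonnegCone : nefCone x ⊆ nonnegCone n := by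
  intro α hα
  have hαL : 0 ≤ inter α (lineClass n) := toN1_linePic (n := n) ▸ hα _ isEffective_linePic
  refine ⟨hαL, ?_⟩
  rw [inter_lineClass] at hαL
  set s := √(∑ i, α.2 i * α.2 i)
  have hs : 0 ≤ s := Real.sqrt_nonneg _
  have hss : ∑ i, α.2 i * α.2 i = s * s :=
    (Real.mul_self_sqrt (Finset.sum_nonneg fun i _ => mul_self_nonneg _)).symm
  have hmem : ((s, α.2) : N1 n) ∈ nonnegCone n :=
    ⟨by rwa [inter_lineClass], by simp only [inter, hss, sub_self, le_refl]⟩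
  have hinter := inter_nonneg_of_mem_nefCone hα (nonnegCone_subset_moriCone (x := x) hmem)
  simp only [inter, hss] at hinter ⊢
  nlinarith

theorem fst_pos_of_mem_nonnegCone {ξ : N1 n} (hξ : ξ ∈ nonnegCone n) (hξ0 : ξ ≠ 0) :
    0 < ξ.1 := by
  obtain ⟨hfst, hself⟩ := hξ
  rw [inter_lineClass] at hfst
  refine lt_of_le_of_ne hfst fun h0 => hξ0 ?_
  have hsum : ∑ i, ξ.2 i * ξ.2 i = 0 := by
    refine le_antisymm ?_ (Finset.sum_nonneg fun i _ => mul_self_nonneg _)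
    rwa [inter, ← h0, mul_zero, zero_sub, neg_nonneg] at hself
  rw [Finset.sum_eq_zero_iff_of_nonneg fun i _ => mul_self_nonneg _] at hsum
  ext i
  · exact h0.symm
  · exact mul_self_eq_zero.mp (hsum i (Finset.mem_univ i))

/-- The nonzero classes on the boundary of the nonnegative cone. -/
structure IsNull (ξ : N1 n) : Prop where
  fst_pos : 0 < ξ.1
  inter_self : inter ξ ξ = 0

theorem isNull_of_mem_frontier {ξ : N1 n} (hξ : ξ ∈ frontier (nonnegCone n)) (hξ0 : ξ ≠ 0) :
    IsNull ξ := by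
  have hmem := isClosed_nonnegCone.frontier_subset hξ
  have hfst := fst_pos_of_mem_nonnegCone hmem hξ0
  refine ⟨hfst, le_antisymm (not_lt.mp fun hpos => hξ.2 ?_) hmem.2⟩
  exact interior_maximal positiveCone_subset_nonnegCone isOpen_positiveCone ⟨hfst, hpos⟩

theorem IsNull.mem_nonnegCone {ξ : N1 n} (hξ : IsNull ξ) : ξ ∈ nonnegCone n :=
  ⟨inter_lineClass ξ ▸ hξ.fst_pos.le, hξ.inter_self.ge⟩

theorem IsNull.inter_self_eq_neg_sum {ξ η : N1 n} (hξ : IsNull ξ) (h : inter ξ η = 0) :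
    inter η η = -∑ i, (η.2 i - η.1 / ξ.1 * ξ.2 i) ^ 2 := by
  have hshift : inter (η - (η.1 / ξ.1) • ξ) (η - (η.1 / ξ.1) • ξ) = inter η η := by
    simp only [inter_sub_left, inter_sub_right, inter_smul_left, inter_smul_right,
      inter_comm η ξ, h, hξ.inter_self, mul_zero, sub_zero]
  have hfst : (η - (η.1 / ξ.1) • ξ).1 = 0 := by simp [hξ.fst_pos.ne']
  rw [← hshift, inter, hfst, zero_mul, zero_sub]
  simp [sq]

theorem IsNull.eq_smul_of_inter_eq_zero {ξ η : N1 n} (hξ : IsNull ξ) (h : inter ξ η = 0)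
    (hη : 0 ≤ inter η η) : η = (η.1 / ξ.1) • ξ := by
  have hsum : ∑ i, (η.2 i - η.1 / ξ.1 * ξ.2 i) ^ 2 = 0 := by
    refine le_antisymm ?_ (Finset.sum_nonneg fun i _ => sq_nonneg _)
    rwa [hξ.inter_self_eq_neg_sum h, neg_nonneg] at hη
  rw [Finset.sum_eq_zero_iff_of_nonneg fun i _ => sq_nonneg _] at hsum
  ext i
  · simp [hξ.fst_pos.ne']
  · exact sub_eq_zero.mp (sq_eq_zero_iff.mp (hsum i (Finset.mem_univ i)))

end NonnegCone

section Combinations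

theorem exists_nat_forall_abs_mul_sub_lt {ι : Type*} [Finite ι] {t : ι → ℝ} (ht : ∀ i, 0 ≤ t i)
    {ε : ℝ} (hε : 0 < ε) : ∃ (q : ℕ) (p : ι → ℕ), 0 < q ∧ ∀ i, |q * t i - p i| < ε := by
  cases nonempty_fintype ι
  let u : ℕ → ι → ℝ := fun k i => Int.fract (k * t i)
  have hu (k : ℕ) : u k ∈ Set.Icc (0 : ι → ℝ) 1 :=
    ⟨fun i => Int.fract_nonneg _, fun i => (Int.fract_lt_one _).le⟩
  obtain ⟨a, -, φ, hφ, hlim⟩ := isCompact_Icc.tendsto_subseq hu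
  obtain ⟨N, hN⟩ := Metric.cauchySeq_iff'.mp hlim.cauchySeq ε hε
  have hlt : φ N < φ (N + 1) := hφ N.lt_succ_self
  have hclose := (dist_pi_lt_iff hε).mp (hN (N + 1) N.le_succ)
  have hfloor (i : ι) : ⌊φ N * t i⌋₊ ≤ ⌊φ (N + 1) * t i⌋₊ :=
    Nat.floor_le_floor (mul_le_mul_of_nonneg_right (Nat.cast_le.mpr hlt.le) (ht i))
  refine ⟨φ (N + 1) - φ N, fun i => ⌊φ (N + 1) * t i⌋₊ - ⌊φ N * t i⌋₊, Nat.sub_pos_of_lt hlt,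
    fun i => ?_⟩
  have hi := hclose i
  rw [Real.dist_eq] at hi
  convert hi using 2
  have hnonneg (k : ℕ) : 0 ≤ k * t i := mul_nonneg k.cast_nonneg (ht i)
  simp only [u, Function.comp_apply, Int.fract, Nat.cast_sub hlt.le, Nat.cast_sub (hfloor i),
    natCast_floor_eq_intCast_floor (hnonneg _)]
  ring

theorem Pic.eq_zero_of_norm_toN1_lt_one {D : Pic n} (hD : ‖D.toN1‖ < 1) : D = 0 := by
  have hfst : |(D.1 : ℝ)| < 1 := (norm_fst_le D.toN1).trans_lt hD
  have hsnd (i : Fin n) : |(D.2 i : ℝ)| < 1 :=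
    ((norm_le_pi_norm D.toN1.2 i).trans (norm_snd_le D.toN1)).trans_lt hD
  ext i
  · exact Int.abs_lt_one_iff.mp (by exact_mod_cast hfst)
  · exact Int.abs_lt_one_iff.mp (by exact_mod_cast hsnd i)

theorem isQEffective_of_sum_smul_eq {ι : Type*} [Fintype ι] {f : ι → Pic n}
    (hf : ∀ i, IsEffective x (f i)) {c : ι → ℝ} (hc : ∀ i, 0 ≤ c i) {D : Pic n}
    (hsum : ∑ i, c i • (f i).toN1 = D.toN1) : IsQEffective x D := by
  set M : ℝ := ∑ i, ‖(f i).toN1‖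
  have : 0 ≤ M := Finset.sum_nonneg fun i _ => norm_nonneg _
  obtain ⟨q, p, hq, hp⟩ := exists_nat_forall_abs_mul_sub_lt hc (ε := 1 / (M + 1)) (by positivity)
  have hdiff : (q • D - ∑ i, p i • f i).toN1 = ∑ i, (q * c i - p i) • (f i).toN1 := by
    simp only [Pic.toN1_sub, Pic.toN1_nsmul, Pic.toN1_sum, ← hsum, Finset.smul_sum, smul_smul,
      sub_smul, Finset.sum_sub_distrib]
  have hnorm : ‖(q • D - ∑ i, p i • f i).toN1‖ < 1 :=
    calc ‖(q • D - ∑ i, p i • f i).toN1‖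
        = ‖∑ i, (q * c i - p i) • (f i).toN1‖ := by rw [hdiff]
      _ ≤ ∑ i, 1 / (M + 1) * ‖(f i).toN1‖ := norm_sum_le_of_le _ fun i _ => by
          rw [norm_smul]
          exact mul_le_mul_of_nonneg_right (hp i).le (norm_nonneg _)
      _ = M / (M + 1) := by rw [← Finset.mul_sum, one_div_mul_eq_div]
      _ < 1 := (div_lt_one (by positivity)).mpr (lt_add_one M)
  refine ⟨q, hq, ?_⟩
  rw [sub_eq_zero.mp (Pic.eq_zero_of_norm_toN1_lt_one hnorm)]
  exact .sum fun i _ => (hf i).nsmul (p i)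

theorem eq_zero_of_sum_smul_eq {D : Pic n} (hD : IsNull D.toN1) (hDQ : ¬IsQEffective x D)
    {ι : Type*} [Fintype ι] {f : ι → Pic n} (hf : ∀ i, IsEffective x (f i)) (hf0 : ∀ i, f i ≠ 0)
    {c : ι → ℝ} (hc : ∀ i, 0 ≤ c i) {r : ℝ} (hsum : ∑ i, c i • (f i).toN1 = r • D.toN1) (i : ι) :
    c i = 0 := by
  have hr : r ≤ 0 := by
    by_contra! hr
    refine hDQ (isQEffective_of_sum_smul_eq hf (c := fun i => r⁻¹ * c i)
      (fun i => mul_nonneg (inv_nonneg.mpr hr.le) (hc i)) ?_)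
    simp only [mul_smul, ← Finset.smul_sum, hsum, inv_smul_smul₀ hr.ne']
  have hpos (i : ι) := inter_ampleClass_pos (hf i) (hf0 i)
  have hterm : ∀ i ∈ Finset.univ, 0 ≤ c i * inter (ampleClass n) (f i).toN1 := fun i _ =>
    mul_nonneg (hc i) (hpos i).le
  have hle : ∑ i, c i * inter (ampleClass n) (f i).toN1 ≤ 0 := by
    have hinter := congrArg (inter (ampleClass n)) hsum
    simp only [inter_sum_right, inter_smul_right] at hinter
    rw [hinter]
    exact mul_nonpos_of_nonpos_of_nonneg hr (inter_nonneg_of_mem_nefCone (x := x)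
      ampleClass_mem_nefCone (nonnegCone_subset_moriCone hD.mem_nonnegCone))
  have hzero := (Finset.sum_eq_zero_iff_of_nonneg hterm).mp
    (hle.antisymm (Finset.sum_nonneg hterm)) i (Finset.mem_univ i)
  exact (mul_eq_zero.mp hzero).resolve_right (hpos i).ne'

end Combinations

section Nef

theorem mem_nefCone_of_not_isQEffective {D : Pic n} (hD : IsNull D.toN1)
    (hDQ : ¬IsQEffective x D) : D.toN1 ∈ nefCone x := by
  intro E hE
  by_contra! hneg
  have hb : 0 < -2 * inter D.toN1 E.toN1 := by linarith
  obtain ⟨N, ⟨hN0, hdegree⟩, hsquare⟩ : ∃ N : ℕ, (0 < N ∧ (E.1 : ℝ) < N * D.toN1.1) ∧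
      -inter E.toN1 E.toN1 < N * (-2 * inter D.toN1 E.toN1) :=
    (((eventually_gt_atTop 0).and
      ((tendsto_natCast_atTop_atTop.atTop_mul_const hD.fst_pos).eventually_gt_atTop _)).and
      ((tendsto_natCast_atTop_atTop.atTop_mul_const hb).eventually_gt_atTop _)).exists
  have hfst : 0 ≤ (N • D - E).1 := by
    have : (E.1 : ℝ) < N * D.1 := hdegree
    rw [Prod.fst_sub, Prod.smul_fst, nsmul_eq_mul, sub_nonneg]
    exact_mod_cast this.le
  have hself : 0 < inter (N • D - E).toN1 (N • D - E).toN1 := by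
    simp only [Pic.toN1_sub, Pic.toN1_nsmul, inter_sub_left, inter_sub_right, inter_smul_left,
      inter_smul_right, hD.inter_self, inter_comm E.toN1 D.toN1]
    linarith
  have hsum := (isQEffective_of_inter_self_pos hfst hself).add hE.isQEffective
  rw [sub_add_cancel] at hsum
  exact hDQ (hsum.of_nsmul hN0)

theorem inter_canonicalClass_nonneg_of_not_isQEffective {D : Pic n} (hD : IsNull D.toN1)
    (hDQ : ¬IsQEffective x D) : 0 ≤ inter D.toN1 (canonicalClass n) := by
  by_contra! hneg
  have hdegree : (0 : ℝ) ≤ D.1 := hD.fst_pos.le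
  exact hDQ (isEffective_of_inter_canonicalClass_le (Int.cast_nonneg_iff.mp hdegree)
    (hD.inter_self ▸ hneg.le)).isQEffective

end Nef

section Rays

theorem self_mem_ray (ξ : N1 n) : ξ ∈ ray ξ := ⟨1, one_pos, (one_smul ℝ ξ).symm⟩

theorem ray_smul (ξ : N1 n) {c : ℝ} (hc : 0 < c) : ray (c • ξ) = ray ξ := by
  ext η
  constructor
  · rintro ⟨t, ht, rfl⟩
    exact ⟨t * c, mul_pos ht hc, smul_smul t c ξ⟩
  · rintro ⟨t, ht, rfl⟩
    exact ⟨t / c, div_pos ht hc, by rw [smul_smul, div_mul_cancel₀ t hc.ne']⟩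

theorem smul_mem_insert_zero_ray (ξ : N1 n) {c : ℝ} (hc : 0 ≤ c) : c • ξ ∈ insert 0 (ray ξ) := by
  obtain rfl | hc := hc.eq_or_lt
  · exact Or.inl (zero_smul ℝ ξ)
  · exact Or.inr ⟨c, hc, rfl⟩

theorem isExtremalRay_of_left_mem {A ρ : Set (N1 n)} (hρ : ρ ⊆ A)
    (h : ∀ α ∈ A, ∀ β ∈ A, α + β ∈ ρ → α ∈ insert 0 ρ) : IsExtremalRay A ρ :=
  ⟨hρ, fun α hα β hβ hαβ => ⟨h α hα β hβ hαβ, h β hβ α hα (add_comm α β ▸ hαβ)⟩⟩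

theorem IsRationalRay.exists_toN1_eq {ρ : Set (N1 n)} (hρ : IsRationalRay ρ) :
    ∃ D : Pic n, D ≠ 0 ∧ ρ = ray D.toN1 := by
  obtain ⟨ξ, hξ0, hξ, rfl⟩ := hρ
  obtain ⟨N, D, hN, hD⟩ := hξ.exists_toN1_eq
  have hN' : (0 : ℝ) < N := Nat.cast_pos.mpr hN
  refine ⟨D, ?_, by rw [hD, ray_smul ξ hN']⟩
  rintro rfl
  exact smul_ne_zero hN'.ne' hξ0 (hD.symm.trans Pic.toN1_zero)

theorem IsQEffective.isEffectiveRay {D : Pic n} (hD : IsQEffective x D) (hD0 : D ≠ 0) :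
    IsEffectiveRay x (ray D.toN1) := by
  obtain ⟨k, hk, hkD⟩ := hD
  exact ⟨k • D, smul_ne_zero hk.ne' hD0, hkD,
    by rw [Pic.toN1_nsmul, ray_smul _ (Nat.cast_pos.mpr hk)]⟩

end Rays

section Extremality

theorem IsNull.inter_eq_zero_of_add_mem_ray {ξ : N1 n} (hξ : IsNull ξ) (hnef : ξ ∈ nefCone x)
    {α β : N1 n} (hα : α ∈ moriCone x) (hβ : β ∈ moriCone x) (hαβ : α + β ∈ ray ξ) :
    inter ξ α = 0 := by
  obtain ⟨c, -, hc⟩ := hαβ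
  have hsum : inter ξ α + inter ξ β = 0 := by
    rw [← inter_add_right, hc, inter_smul_right, hξ.inter_self, mul_zero]
  exact ((add_eq_zero_iff_of_nonneg (inter_nonneg_of_mem_nefCone hnef hα)
    (inter_nonneg_of_mem_nefCone hnef hβ)).mp hsum).1

theorem IsNull.isExtremalRay_nefCone {ξ : N1 n} (hξ : IsNull ξ) (hnef : ξ ∈ nefCone x) :
    IsExtremalRay (nefCone x) (ray ξ) := by
  refine isExtremalRay_of_left_mem ?_ fun α hα β hβ hαβ => ?_
  · rintro _ ⟨c, hc, rfl⟩
    exact smul_mem_nefCone hnef hc.le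
  have hαQ := nefCone_subset_nonnegCone hα
  have hαmori := nonnegCone_subset_moriCone (x := x) hαQ
  have hβmori := nonnegCone_subset_moriCone (x := x) (nefCone_subset_nonnegCone hβ)
  have horth := hξ.inter_eq_zero_of_add_mem_ray hnef hαmori hβmori hαβ
  rw [hξ.eq_smul_of_inter_eq_zero horth hαQ.2]
  exact smul_mem_insert_zero_ray ξ (div_nonneg (fst_nonneg_of_mem_moriCone hαmori) hξ.fst_pos.le)

variable (x) in
/-- The classes of the irreducible curves that do not meet `ξ`. -/
def orthogonalCurves (ξ : N1 n) : Set (Pic n) := {C | IsCurve x C ∧ inter ξ C.toN1 = 0}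

theorem inter_sum_posPart_sum_negPart_nonneg (hx : Function.Injective x) {s : Finset (Pic n)}
    (hs : ∀ C ∈ s, IsCurve x C) (g : Pic n → ℝ) :
    0 ≤ inter (∑ C ∈ s, (g C)⁺ • C.toN1) (∑ C ∈ s, (g C)⁻ • C.toN1) := by
  simp only [inter_sum_left, inter_sum_right, inter_smul_left, inter_smul_right, Finset.mul_sum]
  refine Finset.sum_nonneg fun C hC => Finset.sum_nonneg fun C' hC' => ?_
  obtain rfl | hne := eq_or_ne C C'
  · obtain h | h := le_total (g C) 0 <;> simp [h]
  · exact mul_nonneg (negPart_nonneg _)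
      (mul_nonneg (posPart_nonneg _) ((hs C' hC').inter_nonneg hx (hs C hC) hne.symm))

theorem linearIndepOn_orthogonalCurves (hx : Function.Injective x) {D : Pic n}
    (hD : IsNull D.toN1) (hDQ : ¬IsQEffective x D) :
    LinearIndepOn ℝ Pic.toN1 (orthogonalCurves x D.toN1) := by
  rw [linearIndepOn_iff']
  intro s g hs hg C hC
  set P := ∑ C ∈ s, (g C)⁺ • C.toN1 with hP
  have hP' : P = ∑ C ∈ s, (g C)⁻ • C.toN1 := by
    rw [← sub_eq_zero, hP, ← Finset.sum_sub_distrib, ← hg]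
    exact Finset.sum_congr rfl fun C _ => by rw [← sub_smul, posPart_sub_negPart]
  have horth : inter D.toN1 P = 0 := by
    rw [hP, inter_sum_right]
    exact Finset.sum_eq_zero fun C hC => by rw [inter_smul_right, (hs hC).2, mul_zero]
  have hPP : 0 ≤ inter P P := by
    have := inter_sum_posPart_sum_negPart_nonneg hx (fun C hC => (hs hC).1) g
    rwa [← hP', ← hP] at this
  have hPD := hD.eq_smul_of_inter_eq_zero horth hPP
  have hzero {c : Pic n → ℝ} (hc : ∀ C, 0 ≤ c C) (hPc : P = ∑ C ∈ s, c C • C.toN1) : c C = 0 :=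
    eq_zero_of_sum_smul_eq hD hDQ (f := fun C : s => C.1) (fun C => (hs C.2).1.isEffective)
      (fun C => (hs C.2).1.ne_zero) (c := fun C : s => c C) (fun C => hc C)
      ((Finset.sum_coe_sort s fun C => c C • C.toN1).trans (hPc.symm.trans hPD)) ⟨C, hC⟩
  rw [← posPart_sub_negPart (g C), hzero (fun C => posPart_nonneg (g C)) hP,
    hzero (fun C => negPart_nonneg (g C)) hP', sub_zero]

theorem finite_orthogonalCurves (hx : Function.Injective x) {D : Pic n}
    (hD : IsNull D.toN1) (hDQ : ¬IsQEffective x D) : Finite (orthogonalCurves x D.toN1) :=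
  (linearIndepOn_orthogonalCurves hx hD hDQ).finite

theorem isCompact_setOf_sub_sum_mem_moriCone {ι : Type*} [Fintype ι] {f : ι → Pic n}
    (hf : ∀ i, IsEffective x (f i)) (hf0 : ∀ i, f i ≠ 0) (α : N1 n) :
    IsCompact {t : ι → ℝ | 0 ≤ t ∧ α - ∑ i, t i • (f i).toN1 ∈ moriCone x} := by
  have hpos (i : ι) := inter_ampleClass_pos (hf i) (hf0 i)
  refine (isCompact_Icc (a := 0)
    (b := fun i => inter (ampleClass n) α / inter (ampleClass n) (f i).toN1)).of_isClosed_subset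
    (isClosed_Ici.and (isClosed_moriCone.preimage (by fun_prop))) ?_
  rintro t ⟨ht, hmem⟩
  refine ⟨ht, fun i => ?_⟩
  have hinter := inter_nonneg_of_mem_nefCone ampleClass_mem_nefCone hmem
  simp only [inter_sub_right, inter_sum_right, inter_smul_right, sub_nonneg] at hinter
  rw [le_div_iff₀ (hpos i)]
  exact (Finset.single_le_sum (f := fun i => t i * inter (ampleClass n) (f i).toN1)
    (fun i _ => mul_nonneg (ht i) (hpos i).le) (Finset.mem_univ i)).trans hinter

theorem exists_maximal_sub_sum_mem_moriCone {ι : Type*} [Fintype ι] {f : ι → Pic n}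
    (hf : ∀ i, IsEffective x (f i)) (hf0 : ∀ i, f i ≠ 0) {α : N1 n} (hα : α ∈ moriCone x) :
    ∃ t : ι → ℝ, 0 ≤ t ∧ α - ∑ i, t i • (f i).toN1 ∈ moriCone x ∧
      ∀ i, ∀ r : ℝ, 0 < r → α - ∑ i, t i • (f i).toN1 - r • (f i).toN1 ∉ moriCone x := by
  classical
  obtain ⟨t, ⟨ht, hmem⟩, hmax⟩ := (isCompact_setOf_sub_sum_mem_moriCone hf hf0 α).exists_isMaxOn
    ⟨0, le_rfl, by simpa using hα⟩ (f := fun t => ∑ i, t i) (by fun_prop)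
  refine ⟨t, ht, hmem, fun i r hr hsub => ?_⟩
  set t' : ι → ℝ := t + Pi.single i r with ht'
  have hsum : ∑ j, t' j • (f j).toN1 = ∑ j, t j • (f j).toN1 + r • (f i).toN1 := by
    simp [ht', add_smul, Finset.sum_add_distrib, Pi.single_apply, ite_smul]
  have hle : ∑ j, t' j ≤ ∑ j, t j :=
    hmax ⟨add_nonneg ht (Pi.single_nonneg.mpr hr.le), by rwa [hsum, ← sub_sub]⟩
  simp only [ht', Pi.add_apply, Finset.sum_add_distrib, Finset.sum_pi_single', Finset.mem_univ,
    if_true] at hle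
  linarith

theorem mem_nefCone_of_forall_orthogonalCurves (hx : Function.Injective x) {ξ : N1 n}
    (hnef : ξ ∈ nefCone x) {α : N1 n} (hα : α ∈ moriCone x) (hξα : inter ξ α = 0)
    (hmax : ∀ C ∈ orthogonalCurves x ξ, ∀ r : ℝ, 0 < r → α - r • C.toN1 ∉ moriCone x) :
    α ∈ nefCone x := by
  refine mem_nefCone_of_forall_isCurve fun C hC => ?_
  by_contra! hαC
  have hCC := hC.inter_self_neg hx hα hαC
  have hsub := hC.sub_max_smul_mem_moriCone hx hCC hα
  have hr : 0 < inter α C.toN1 / inter C.toN1 C.toN1 := div_pos_of_neg_of_neg hαC hCC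
  rw [max_eq_left hr.le] at hsub
  refine hmax C ⟨hC, le_antisymm ?_ (hnef C hC.isEffective)⟩ _ hr hsub
  have hinter := inter_nonneg_of_mem_nefCone hnef hsub
  rw [inter_sub_right, hξα, inter_smul_right, zero_sub, neg_nonneg] at hinter
  exact nonpos_of_mul_nonpos_right hinter hr

theorem IsNull.exists_eq_smul_add_sum (hx : Function.Injective x) {ξ : N1 n} (hξ : IsNull ξ)
    (hnef : ξ ∈ nefCone x) [Fintype (orthogonalCurves x ξ)] {α : N1 n} (hα : α ∈ moriCone x)
    (hξα : inter ξ α = 0) :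
    ∃ (a : ℝ) (t : orthogonalCurves x ξ → ℝ), 0 ≤ a ∧ 0 ≤ t ∧
      α = a • ξ + ∑ C, t C • C.1.toN1 := by
  obtain ⟨t, ht, hmem, hmax⟩ := exists_maximal_sub_sum_mem_moriCone
    (f := fun C : orthogonalCurves x ξ => C.1) (fun C => C.2.1.isEffective)
    (fun C => C.2.1.ne_zero) hα
  set α' := α - ∑ C, t C • C.1.toN1 with hα'
  have hξα' : inter ξ α' = 0 := by
    rw [hα', inter_sub_right, hξα, inter_sum_right, zero_sub, neg_eq_zero]
    exact Finset.sum_eq_zero fun C _ => by rw [inter_smul_right, C.2.2, mul_zero]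
  have hα'nef : α' ∈ nefCone x :=
    mem_nefCone_of_forall_orthogonalCurves hx hnef hmem hξα' fun C hC => hmax ⟨C, hC⟩
  refine ⟨α'.1 / ξ.1, t, div_nonneg (fst_nonneg_of_mem_moriCone hmem) hξ.fst_pos.le, ht, ?_⟩
  rw [← hξ.eq_smul_of_inter_eq_zero hξα' (inter_nonneg_of_mem_nefCone hα'nef hmem), hα',
    sub_add_cancel]

theorem isExtremalRay_moriCone_of_not_isQEffective (hx : Function.Injective x) {D : Pic n}
    (hD : IsNull D.toN1) (hDQ : ¬IsQEffective x D) : IsExtremalRay (moriCone x) (ray D.toN1) := by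
  have hnef := mem_nefCone_of_not_isQEffective hD hDQ
  have := finite_orthogonalCurves hx hD hDQ
  have := Fintype.ofFinite (orthogonalCurves x D.toN1)
  refine isExtremalRay_of_left_mem ?_ fun α hα β hβ hαβ => ?_
  · exact (hD.isExtremalRay_nefCone hnef).1.trans
      (nefCone_subset_nonnegCone.trans nonnegCone_subset_moriCone)
  obtain ⟨a, t, ha, ht, rfl⟩ := hD.exists_eq_smul_add_sum hx hnef hα
    (hD.inter_eq_zero_of_add_mem_ray hnef hα hβ hαβ)
  obtain ⟨b, s, -, hs, rfl⟩ := hD.exists_eq_smul_add_sum hx hnef hβ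
    (hD.inter_eq_zero_of_add_mem_ray hnef hβ hα (add_comm _ β ▸ hαβ))
  obtain ⟨c, -, hc⟩ := hαβ
  have hsum : ∑ C, (t + s) C • C.1.toN1 = (c - a - b) • D.toN1 := by
    simp only [Pi.add_apply, add_smul, Finset.sum_add_distrib, sub_smul, ← hc]
    abel
  have hts (C : orthogonalCurves x D.toN1) : t C + s C = 0 :=
    eq_zero_of_sum_smul_eq hD hDQ (fun C => C.2.1.isEffective) (fun C => C.2.1.ne_zero)
      (fun C => add_nonneg (ht C) (hs C)) hsum C
  have ht0 (C : orthogonalCurves x D.toN1) : t C = 0 :=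
    ((add_eq_zero_iff_of_nonneg (ht C) (hs C)).mp (hts C)).1
  simp only [ht0, zero_smul, Finset.sum_const_zero, add_zero]
  exact smul_mem_insert_zero_ray _ ha

end Extremality

end BlownUpPlane

theorem mainTheorem10 (n : ℕ) (x : Fin n → BlownUpPlane.Plane) (hx : Function.Injective x)
    (ρ : Set (BlownUpPlane.N1 n)) (hrat : BlownUpPlane.IsRationalRay ρ)
    (hbd : ρ ⊆ frontier (BlownUpPlane.nonnegCone n))
    (hneff : ¬ BlownUpPlane.IsEffectiveRay x ρ) :
    ρ ⊆ BlownUpPlane.nefCone x ∧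
    BlownUpPlane.IsExtremalRay (BlownUpPlane.moriCone x) ρ ∧
    BlownUpPlane.IsExtremalRay (BlownUpPlane.nefCone x) ρ ∧
    ρ ⊆ frontier (BlownUpPlane.nonnegCone n) ∩ BlownUpPlane.moriConeKNonneg x := by
  open BlownUpPlane in
  obtain ⟨D, hD0, rfl⟩ := hrat.exists_toN1_eq
  have hDnull : IsNull D.toN1 := isNull_of_mem_frontier (hbd (self_mem_ray _)) fun h =>
    hD0 (Pic.toN1_injective (h.trans Pic.toN1_zero.symm))
  have hDQ : ¬IsQEffective x D := fun h => hneff (h.isEffectiveRay hD0)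
  have hextNef := hDnull.isExtremalRay_nefCone (mem_nefCone_of_not_isQEffective hDnull hDQ)
  have hextMori := isExtremalRay_moriCone_of_not_isQEffective hx hDnull hDQ
  refine ⟨hextNef.1, hextMori, hextNef, fun η hη => ⟨hbd hη, hextMori.1 hη, ?_⟩⟩
  obtain ⟨c, hc, rfl⟩ := hη
  rw [inter_smul_left]
  exact mul_nonneg hc.le (inter_canonicalClass_nonneg_of_not_isQEffective hDnull hDQ)
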